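/- All graphs are finite and simple; $Y$ has at least one vertex. For graphs $X,Y$ let $X[Y]$ be the lexicographic product: its vertex set is $V(X)\times V(Y)$, and $(x,y)\sim(x',y')$ iff $xx'\in E(X)$, or $x=x'$ and $yy'\in E(Y)$. Let $K_n$ be the complete graph on $n$ vertices and $\overline{K_n}$ its complement. A quantum permutation group on a finite set $I$ is given by a pair $\mathbb G=(C(\mathbb G),u)$, where $C(\mathbb G)$ is a unital $C^*$-algebra generated by the entries of a magic unitary $u=(u_{ij})_{i,j\in I}$ (the entries are projections, and every row and column sums to $1$), with comultiplication $\Delta(u_{ij})=\sum_k u_{ik}\otimes u_{kj}$. Equality of two quantum permutation groups means that matching the entries of the fundamental representations, $u_{ij}\mapsto v_{ij}$, defines a $*$-isomorphism of the $C^*$-algebras (after identifying the index sets, where these differ). For a graph $X$, $\mathrm{Qut}(X)$ is the quantum permutation group on $V(X)$ whose $C^*$-algebra is the universal one generated by a magic unitary $(u_{ij})$ with $u_{ij}u_{kl}=0$ whenever exactly one of $ik$, $jl$ is an edge of $X$; $\mathbb S_n^+$ is the quantum permutation group on $\{1,\dots,n\}$ whose $C^*$-algebra is the universal one generated by an $n\times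 n$ magic unitary. For $\mathbb G=(C(\mathbb G),u)$ on $I$ and $\mathbb H=(C(\mathbb H),v)$ on $J$, the free wreath product $\mathbb G\wr_*\mathbb H$ on $J\times I$ has as $C^*$-algebra the unital free product of copies $C(\mathbb G)^{(a)}$ $(a\in J)$ of $C(\mathbb G)$ and of $C(\mathbb H)$, modulo the relations $u^{(a)}_{ij}v_{ab}=v_{ab}u^{(a)}_{ij}$, and fundamental representation $w_{(a,i)(b,j)}=u^{(a)}_{ij}v_{ab}$. A graph $X$ is quantum vertex transitive if all entries of the fundamental representation of $\mathrm{Qut}(X)$ are nonzero. **Proposition.** Let $X$ be a quantum vertex transitive graph and $Y$ a vertex transitive graph. If $\mathrm{Qut}(X[Y])\neq \mathrm{Qut}(Y)\wr_*\mathrm{Qut}(X)$, then there exist integers $\alpha,\beta>1$, a quantum vertex transitive graph $X'$ and a vertex transitive graph $Y'$ such that 1. $X\cong X'[\overline{K_\alpha}]$ and $Y\cong\overline{K_\beta}[Y']$, or 2. $X\cong X'[K_\alpha]$ and $Y\cong K_\beta[Y']$. Maximal such $\alpha,\beta$ exist. Whenever $\alpha,\beta>1$ are maximal with the property that there are such decompositions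 (both of type 1, or both of type 2), then for all such $X'$, $Y'$ and all isomorphisms as in that type, $$\mathrm{Qut}(X[Y])=(\mathrm{Qut}(Y')\wr_*\mathbb S^+_{\alpha\beta})\wr_*\mathrm{Qut}(X'),$$ where $V(X)\times V(Y)$ is identified with $V(X')\times(\{1,\dots,\alpha\beta\}\times V(Y'))$ through the given isomorphisms and a fixed bijection $\{1,\dots,\alpha\}\times\{1,\dots,\beta\}\to\{1,\dots,\alpha\beta\}$. -/

import Mathlib

noncomputable section

/-! ### The free unital `*`-algebra on a set of generators -/

/-- The free unital complex `*`-algebra on `G`: noncommutative polynomials in the letters `g`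
(`Sum.inl g`) and `g⋆` (`Sum.inr g`). -/
def FreeStarAlg (G : Type) : Type := FreeAlgebra ℂ (G ⊕ G)

namespace FreeStarAlg

variable {G : Type}

instance : Ring (FreeStarAlg G) := inferInstanceAs (Ring (FreeAlgebra ℂ (G ⊕ G)))

instance : Algebra ℂ (FreeStarAlg G) := inferInstanceAs (Algebra ℂ (FreeAlgebra ℂ (G ⊕ G)))

/-- The generator `g`. -/
def gen (g : G) : FreeStarAlg G := FreeAlgebra.ι ℂ (Sum.inl g : G ⊕ G)

/-- The formal adjoint `g⋆` of the generator `g`. -/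
def genStar (g : G) : FreeStarAlg G := FreeAlgebra.ι ℂ (Sum.inr g : G ⊕ G)

theorem induction {p : FreeStarAlg G → Prop} (scalar : ∀ z : ℂ, p (algebraMap ℂ _ z))
    (hgen : ∀ g, p (gen g)) (hgenStar : ∀ g, p (genStar g))
    (mul : ∀ a b, p a → p b → p (a * b)) (add : ∀ a b, p a → p b → p (a + b))
    (x : FreeStarAlg G) : p x :=
  FreeAlgebra.induction ℂ (G ⊕ G) (motive := p) scalar
    (fun s => by cases s with
      | inl g => exact hgen g
      | inr g => exact hgenStar g) mul add x

/-- The opposite algebra with conjugated scalars; the adjoint is an algebra homomorphism into it. -/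
abbrev conjOpAlgebra : Algebra ℂ (FreeStarAlg G)ᵐᵒᵖ :=
  ((algebraMap ℂ (FreeStarAlg G)ᵐᵒᵖ).comp (starRingEnd ℂ)).toAlgebra'
    (fun c x => Algebra.commutes (starRingEnd ℂ c) x)

/-- The adjoint, as a ring homomorphism into the opposite algebra. -/
def starAux : FreeStarAlg G →+* (FreeStarAlg G)ᵐᵒᵖ :=
  letI : Algebra ℂ (FreeStarAlg G)ᵐᵒᵖ := conjOpAlgebra
  (FreeAlgebra.lift ℂ (fun s : G ⊕ G =>
    MulOpposite.op (Sum.elim genStar gen s : FreeStarAlg G))).toRingHom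

theorem starAux_gen (g : G) : starAux (gen g) = MulOpposite.op (genStar g) := by
  let _ : Algebra ℂ (FreeStarAlg G)ᵐᵒᵖ := conjOpAlgebra
  exact FreeAlgebra.lift_ι_apply (R := ℂ) (fun s : G ⊕ G =>
    MulOpposite.op (Sum.elim genStar gen s : FreeStarAlg G)) (Sum.inl g)

theorem starAux_genStar (g : G) : starAux (genStar g) = MulOpposite.op (gen g) := by
  let _ : Algebra ℂ (FreeStarAlg G)ᵐᵒᵖ := conjOpAlgebra
  exact FreeAlgebra.lift_ι_apply (R := ℂ) (fun s : G ⊕ G =>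
    MulOpposite.op (Sum.elim genStar gen s : FreeStarAlg G)) (Sum.inr g)

theorem starAux_algebraMap (z : ℂ) : starAux (algebraMap ℂ (FreeStarAlg G) z) =
    MulOpposite.op (algebraMap ℂ (FreeStarAlg G) (starRingEnd ℂ z)) := by
  let _ : Algebra ℂ (FreeStarAlg G)ᵐᵒᵖ := conjOpAlgebra
  exact (FreeAlgebra.lift ℂ (fun s : G ⊕ G =>
    MulOpposite.op (Sum.elim genStar gen s : FreeStarAlg G))).commutes z

instance : StarRing (FreeStarAlg G) where
  star x := (starAux x).unop
  star_involutive x := by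
    induction x using induction with
    | scalar z => simp [starAux_algebraMap]
    | hgen g => simp [starAux_gen, starAux_genStar]
    | hgenStar g => simp [starAux_gen, starAux_genStar]
    | mul a b ha hb => simp [ha, hb]
    | add a b ha hb => simp [ha, hb]
  star_mul a b := by simp
  star_add a b := by simp

theorem star_gen (g : G) : star (gen g) = genStar g :=
  congrArg MulOpposite.unop (starAux_gen g)

theorem star_genStar (g : G) : star (genStar g) = gen g :=
  congrArg MulOpposite.unop (starAux_genStar g)

theorem star_algebraMap' (z : ℂ) : star (algebraMap ℂ (FreeStarAlg G) z) =
    algebraMap ℂ (FreeStarAlg G) (star z) :=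
  congrArg MulOpposite.unop (starAux_algebraMap z)

instance : StarModule ℂ (FreeStarAlg G) where
  star_smul z x := by
    rw [Algebra.smul_def, star_mul, star_algebraMap', Algebra.smul_def, Algebra.commutes]

variable {B : Type} [CStarAlgebra B]

/-- Evaluation of noncommutative `*`-polynomials at a family `T` of elements of `B`. -/
def eval (T : G → B) : FreeStarAlg G →⋆ₐ[ℂ] B where
  __ := (FreeAlgebra.lift ℂ (Sum.elim T (fun g => star (T g))) : FreeAlgebra ℂ (G ⊕ G) →ₐ[ℂ] B)
  map_star' x := by
    let L : FreeStarAlg G →ₐ[ℂ] B :=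
      (FreeAlgebra.lift ℂ (Sum.elim T (fun g => star (T g))) : FreeAlgebra ℂ (G ⊕ G) →ₐ[ℂ] B)
    have h1 : ∀ g, L (gen g) = T g := fun g =>
      FreeAlgebra.lift_ι_apply (R := ℂ) (Sum.elim T (fun g => star (T g))) (Sum.inl g)
    have h2 : ∀ g, L (genStar g) = star (T g) := fun g =>
      FreeAlgebra.lift_ι_apply (R := ℂ) (Sum.elim T (fun g => star (T g))) (Sum.inr g)
    change L (star x) = star (L x)
    induction x using induction with
    | scalar z => rw [star_algebraMap', AlgHom.commutes, AlgHom.commutes, algebraMap_star_comm]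
    | hgen g => rw [star_gen, h1, h2]
    | hgenStar g => rw [star_genStar, h1, h2, star_star]
    | mul a b ha hb => rw [star_mul, map_mul, map_mul, star_mul, ha, hb]
    | add a b ha hb => rw [star_add, map_add, map_add, star_add, ha, hb]

theorem eval_gen (T : G → B) (g : G) : eval T (gen g) = T g :=
  FreeAlgebra.lift_ι_apply (R := ℂ) (Sum.elim T (fun g => star (T g))) (Sum.inl g)

theorem eval_genStar (T : G → B) (g : G) : eval T (genStar g) = star (T g) :=
  FreeAlgebra.lift_ι_apply (R := ℂ) (Sum.elim T (fun g => star (T g))) (Sum.inr g)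

end FreeStarAlg

/-! ### Universal unital `C*`-algebras -/

/-- Generators and `*`-polynomial relations (each `r ∈ Rel` stands for the relation `r = 0`) such
that the norm of every generator is bounded over all representations. -/
structure CStarPresentation where
  Gen : Type
  Rel : Set (FreeStarAlg Gen)
  bounded : ∀ g : Gen, ∃ C : ℝ, ∀ (B : Type) [CStarAlgebra B] (T : Gen → B),
    (∀ r ∈ Rel, FreeStarAlg.eval T r = 0) → ‖T g‖ ≤ C

namespace CStarPresentation

variable (P : CStarPresentation)

/-- A representation of `P`: a family in a unital `C*`-algebra satisfying the relations. (A unital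
`C*`-algebra is the same thing as a unital closed `*`-algebra of bounded operators.) -/
def IsRep {B : Type} [CStarAlgebra B] (T : P.Gen → B) : Prop :=
  ∀ r ∈ P.Rel, FreeStarAlg.eval T r = 0

/-- The norms of `x` in all representations. -/
def normSet (x : FreeStarAlg P.Gen) : Set ℝ :=
  {c | ∃ (B : Type) (_ : CStarAlgebra B) (T : P.Gen → B),
    P.IsRep T ∧ c = ‖FreeStarAlg.eval T x‖}

theorem normSet_bddAbove (x : FreeStarAlg P.Gen) : BddAbove (P.normSet x) := by
  induction x using FreeStarAlg.induction with
  | scalar z =>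
    refine ⟨‖z‖, ?_⟩
    rintro _ ⟨B, _, T, -, rfl⟩
    rw [AlgHomClass.commutes, Algebra.algebraMap_eq_smul_one, norm_smul]
    have h1 : ‖(1 : B)‖ ≤ 1 := by
      rcases subsingleton_or_nontrivial B with h | h
      · rw [Subsingleton.elim (1 : B) 0, norm_zero]; exact zero_le_one
      · rw [CStarRing.norm_one]
    exact mul_le_of_le_one_right (norm_nonneg z) h1
  | hgen g =>
    obtain ⟨C, hC⟩ := P.bounded g
    refine ⟨C, ?_⟩
    rintro _ ⟨B, _, T, hT, rfl⟩
    rw [FreeStarAlg.eval_gen]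
    exact hC B T hT
  | hgenStar g =>
    obtain ⟨C, hC⟩ := P.bounded g
    refine ⟨C, ?_⟩
    rintro _ ⟨B, _, T, hT, rfl⟩
    rw [FreeStarAlg.eval_genStar, norm_star]
    exact hC B T hT
  | mul a b ha hb =>
    obtain ⟨C, hC⟩ := ha
    obtain ⟨D, hD⟩ := hb
    refine ⟨C * D, ?_⟩
    rintro _ ⟨B, _, T, hT, rfl⟩
    have h1 : ‖FreeStarAlg.eval T a‖ ≤ C := hC ⟨B, _, T, hT, rfl⟩
    have h2 : ‖FreeStarAlg.eval T b‖ ≤ D := hD ⟨B, _, T, hT, rfl⟩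
    rw [map_mul]
    exact (norm_mul_le _ _).trans
      (mul_le_mul h1 h2 (norm_nonneg _) ((norm_nonneg _).trans h1))
  | add a b ha hb =>
    obtain ⟨C, hC⟩ := ha
    obtain ⟨D, hD⟩ := hb
    refine ⟨C + D, ?_⟩
    rintro _ ⟨B, _, T, hT, rfl⟩
    have h1 : ‖FreeStarAlg.eval T a‖ ≤ C := hC ⟨B, _, T, hT, rfl⟩
    have h2 : ‖FreeStarAlg.eval T b‖ ≤ D := hD ⟨B, _, T, hT, rfl⟩
    rw [map_add]
    exact (norm_add_le _ _).trans (add_le_add h1 h2)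

/-- The largest `C*`-seminorm: the supremum of `‖π(x)‖` over all representations `π` of `P`. -/
def universalNorm (x : FreeStarAlg P.Gen) : ℝ := sSup (P.normSet x)

theorem le_universalNorm {B : Type} [i : CStarAlgebra B] {T : P.Gen → B} (hT : P.IsRep T)
    (x : FreeStarAlg P.Gen) : ‖FreeStarAlg.eval T x‖ ≤ P.universalNorm x :=
  le_csSup (P.normSet_bddAbove x) ⟨B, i, T, hT, rfl⟩

theorem universalNorm_nonneg (x : FreeStarAlg P.Gen) : 0 ≤ P.universalNorm x :=
  Real.sSup_nonneg (by rintro _ ⟨B, _, T, -, rfl⟩; exact norm_nonneg _)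

theorem universalNorm_le {x : FreeStarAlg P.Gen} {c : ℝ} (hc : 0 ≤ c)
    (h : ∀ (B : Type) [CStarAlgebra B] (T : P.Gen → B), P.IsRep T →
      ‖FreeStarAlg.eval T x‖ ≤ c) : P.universalNorm x ≤ c :=
  Real.sSup_le (by rintro _ ⟨B, _, T, hT, rfl⟩; exact h B T hT) hc

theorem universalNorm_star (x : FreeStarAlg P.Gen) :
    P.universalNorm (star x) = P.universalNorm x := by
  have key : ∀ y, P.universalNorm (star y) ≤ P.universalNorm y := fun y =>
    P.universalNorm_le (P.universalNorm_nonneg y) fun B _ T hT => by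
      rw [map_star, norm_star]; exact P.le_universalNorm hT y
  exact le_antisymm (key x) (by simpa using key (star x))

theorem universalNorm_zero : P.universalNorm 0 = 0 :=
  le_antisymm (P.universalNorm_le le_rfl fun B _ T _ => by rw [map_zero, norm_zero])
    (P.universalNorm_nonneg _)

theorem universalNorm_neg (x : FreeStarAlg P.Gen) :
    P.universalNorm (-x) = P.universalNorm x := by
  have key : ∀ y, P.universalNorm (-y) ≤ P.universalNorm y := fun y =>
    P.universalNorm_le (P.universalNorm_nonneg y) fun B _ T hT => by
      rw [map_neg, norm_neg]; exact P.le_universalNorm hT y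
  exact le_antisymm (key x) (by simpa using key (-x))

theorem universalNorm_add (x y : FreeStarAlg P.Gen) :
    P.universalNorm (x + y) ≤ P.universalNorm x + P.universalNorm y :=
  P.universalNorm_le (add_nonneg (P.universalNorm_nonneg _) (P.universalNorm_nonneg _))
    fun B _ T hT => by
      rw [map_add]
      exact (norm_add_le _ _).trans
        (add_le_add (P.le_universalNorm hT _) (P.le_universalNorm hT _))

theorem universalNorm_mul (x y : FreeStarAlg P.Gen) :
    P.universalNorm (x * y) ≤ P.universalNorm x * P.universalNorm y :=
  P.universalNorm_le (mul_nonneg (P.universalNorm_nonneg _) (P.universalNorm_nonneg _))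
    fun B _ T hT => by
      rw [map_mul]
      exact (norm_mul_le _ _).trans (mul_le_mul (P.le_universalNorm hT _)
        (P.le_universalNorm hT _) (norm_nonneg _) (P.universalNorm_nonneg _))

theorem universalNorm_smul (z : ℂ) (x : FreeStarAlg P.Gen) :
    P.universalNorm (z • x) ≤ ‖z‖ * P.universalNorm x :=
  P.universalNorm_le (mul_nonneg (norm_nonneg _) (P.universalNorm_nonneg _))
    fun B _ T hT => by
      rw [map_smul, norm_smul]
      exact mul_le_mul_of_nonneg_left (P.le_universalNorm hT _) (norm_nonneg _)

theorem universalNorm_mul_self_le (x : FreeStarAlg P.Gen) :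
    P.universalNorm x * P.universalNorm x ≤ P.universalNorm (star x * x) := by
  have h : P.universalNorm x ≤ Real.sqrt (P.universalNorm (star x * x)) :=
    P.universalNorm_le (Real.sqrt_nonneg _) fun B _ T hT => by
      refine Real.le_sqrt_of_sq_le ?_
      rw [sq, ← CStarRing.norm_star_mul_self, ← map_star, ← map_mul]
      exact P.le_universalNorm hT _
  calc P.universalNorm x * P.universalNorm x
      ≤ Real.sqrt (P.universalNorm (star x * x)) * Real.sqrt (P.universalNorm (star x * x)) :=
        mul_le_mul h h (P.universalNorm_nonneg _) (Real.sqrt_nonneg _)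
    _ = P.universalNorm (star x * x) := Real.mul_self_sqrt (P.universalNorm_nonneg _)

/-- The free `*`-algebra on the generators of `P`, equipped with the universal seminorm. -/
def Pre : Type := FreeStarAlg P.Gen

namespace Pre

instance : Ring P.Pre := inferInstanceAs (Ring (FreeStarAlg P.Gen))

instance : Algebra ℂ P.Pre := inferInstanceAs (Algebra ℂ (FreeStarAlg P.Gen))

instance : StarRing P.Pre := inferInstanceAs (StarRing (FreeStarAlg P.Gen))

/-- The universal seminorm as a group seminorm. -/
def groupSeminorm : AddGroupSeminorm P.Pre where
  toFun := P.universalNorm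
  map_zero' := P.universalNorm_zero
  add_le' := P.universalNorm_add
  neg' := P.universalNorm_neg

instance : SeminormedAddCommGroup P.Pre := (groupSeminorm P).toSeminormedAddCommGroup

instance : SeminormedRing P.Pre where
  __ := (inferInstance : SeminormedAddCommGroup P.Pre)
  __ := (inferInstance : Ring P.Pre)
  norm_mul_le := P.universalNorm_mul

instance : NormedAlgebra ℂ P.Pre where
  norm_smul_le := P.universalNorm_smul

instance : NormedStarGroup P.Pre where
  norm_star_le x := (P.universalNorm_star x).le

end Pre

/-- The universal unital `C*`-algebra `C*(Gen | Rel)`: the Hausdorff completion of the free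
`*`-algebra for the universal seminorm. -/
def Universal : Type := UniformSpace.Completion P.Pre

namespace Universal

open UniformSpace

instance : NormedRing P.Universal := inferInstanceAs (NormedRing (Completion P.Pre))

instance : CompleteSpace P.Universal := inferInstanceAs (CompleteSpace (Completion P.Pre))

instance : NormedAlgebra ℂ P.Universal where
  __ := (inferInstance : Algebra ℂ (Completion P.Pre))
  norm_smul_le := (inferInstance : NormedSpace ℂ (Completion P.Pre)).norm_smul_le

/-- The image of a `*`-polynomial in the universal `C*`-algebra. -/
def mk (x : FreeStarAlg P.Gen) : P.Universal := Completion.coe' (α := P.Pre) x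

theorem denseRange_mk : DenseRange (mk P) := Completion.denseRange_coe (α := P.Pre)

theorem mk_mul (x y : FreeStarAlg P.Gen) : mk P (x * y) = mk P x * mk P y :=
  Completion.coe_mul (α := P.Pre) x y

theorem mk_add (x y : FreeStarAlg P.Gen) : mk P (x + y) = mk P x + mk P y :=
  Completion.coe_add (α := P.Pre) x y

theorem norm_mk (x : FreeStarAlg P.Gen) : ‖mk P x‖ = P.universalNorm x :=
  Completion.norm_coe (E := P.Pre) x

theorem mk_smul (z : ℂ) (x : FreeStarAlg P.Gen) : mk P (z • x) = z • mk P x :=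
  Completion.coe_smul (X := P.Pre) z x

/-- The continuous extension of the adjoint to the completion. -/
def adjoint : P.Universal → P.Universal := Completion.map (star : P.Pre → P.Pre)

theorem uniformContinuous_star_pre : UniformContinuous (star : P.Pre → P.Pre) := by
  have h : Isometry (star : P.Pre → P.Pre) := star_isometry
  exact h.uniformContinuous

theorem continuous_adjoint : Continuous (adjoint P) := Completion.continuous_map

theorem adjoint_mk (x : FreeStarAlg P.Gen) : adjoint P (mk P x) = mk P (star x) :=
  Completion.map_coe (uniformContinuous_star_pre P) (show P.Pre from x)

theorem adjoint_adjoint (x : P.Universal) : adjoint P (adjoint P x) = x := by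
  refine (denseRange_mk P).induction_on (p := fun x => adjoint P (adjoint P x) = x) x ?_ ?_
  · exact isClosed_eq ((continuous_adjoint P).comp (continuous_adjoint P)) continuous_id
  · intro x
    rw [adjoint_mk, adjoint_mk, star_star]

theorem adjoint_mul (x y : P.Universal) :
    adjoint P (x * y) = adjoint P y * adjoint P x := by
  refine (denseRange_mk P).induction_on₂
    (p := fun x y => adjoint P (x * y) = adjoint P y * adjoint P x) ?_ ?_ x y
  · exact isClosed_eq ((continuous_adjoint P).comp continuous_mul)
      (((continuous_adjoint P).comp continuous_snd).mul
        ((continuous_adjoint P).comp continuous_fst))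
  · intro x y
    rw [← mk_mul, adjoint_mk, adjoint_mk, adjoint_mk, star_mul, mk_mul]

theorem adjoint_add (x y : P.Universal) :
    adjoint P (x + y) = adjoint P x + adjoint P y := by
  refine (denseRange_mk P).induction_on₂
    (p := fun x y => adjoint P (x + y) = adjoint P x + adjoint P y) ?_ ?_ x y
  · exact isClosed_eq ((continuous_adjoint P).comp continuous_add)
      (((continuous_adjoint P).comp continuous_fst).add
        ((continuous_adjoint P).comp continuous_snd))
  · intro x y
    rw [← mk_add, adjoint_mk, adjoint_mk, adjoint_mk, star_add, mk_add]

instance : StarRing P.Universal where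
  star := adjoint P
  star_involutive := adjoint_adjoint P
  star_mul := adjoint_mul P
  star_add := adjoint_add P

theorem mk_star (x : FreeStarAlg P.Gen) : mk P (star x) = star (mk P x) :=
  (adjoint_mk P x).symm

theorem continuous_star' : Continuous (star : P.Universal → P.Universal) :=
  continuous_adjoint P

instance : CStarAlgebra P.Universal where
  norm_mul_self_le x := by
    refine (denseRange_mk P).induction_on (p := fun x => ‖x‖ * ‖x‖ ≤ ‖star x * x‖) x ?_ ?_
    · exact isClosed_le (continuous_norm.mul continuous_norm)
        (((continuous_star' P).mul continuous_id).norm)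
    · intro x
      rw [← mk_star, ← mk_mul, norm_mk, norm_mk]
      exact P.universalNorm_mul_self_le x
  star_smul z x := by
    refine (denseRange_mk P).induction_on (p := fun x => star (z • x) = star z • star x) x ?_ ?_
    · exact isClosed_eq ((continuous_star' P).comp (continuous_const_smul z))
        ((continuous_star' P).const_smul (star z))
    · intro x
      rw [← mk_smul, ← mk_star, ← mk_star, star_smul, mk_smul]

/-- The canonical `*`-homomorphism from `*`-polynomials to the universal `C*`-algebra. -/
def mkHom : FreeStarAlg P.Gen →⋆ₐ[ℂ] P.Universal where
  toFun := mk P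
  map_one' := Completion.coe_one P.Pre
  map_mul' := mk_mul P
  map_zero' := Completion.coe_zero (α := P.Pre)
  map_add' := mk_add P
  commutes' z := by
    rw [Algebra.algebraMap_eq_smul_one, Algebra.algebraMap_eq_smul_one, mk_smul]
    exact congrArg (z • ·) (Completion.coe_one P.Pre)
  map_star' := mk_star P

/-- The generators of the universal `C*`-algebra. -/
def gen (g : P.Gen) : P.Universal := mkHom P (FreeStarAlg.gen g)

theorem mkHom_eq_zero {r : FreeStarAlg P.Gen} (hr : r ∈ P.Rel) : mkHom P r = 0 := by
  rw [← norm_eq_zero]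
  refine le_antisymm ?_ (norm_nonneg _)
  refine (norm_mk P r).le.trans (P.universalNorm_le le_rfl fun B _ T hT => ?_)
  rw [hT r hr, norm_zero]

/-- The generators generate the universal `C*`-algebra. -/
theorem adjoin_gen :
    (StarAlgebra.adjoin ℂ (Set.range (gen P))).topologicalClosure = ⊤ := by
  have h : ∀ x, mkHom P x ∈ StarAlgebra.adjoin ℂ (Set.range (gen P)) := by
    intro x
    induction x using FreeStarAlg.induction with
    | scalar z => rw [AlgHomClass.commutes]; exact algebraMap_mem _ z
    | hgen g => exact StarAlgebra.subset_adjoin ℂ _ ⟨g, rfl⟩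
    | hgenStar g =>
      rw [← FreeStarAlg.star_gen, map_star]
      exact star_mem (StarAlgebra.subset_adjoin ℂ _ ⟨g, rfl⟩)
    | mul a b ha hb => rw [map_mul]; exact mul_mem ha hb
    | add a b ha hb => rw [map_add]; exact add_mem ha hb
  refine top_le_iff.mp fun y _ => ?_
  change y ∈ closure (StarAlgebra.adjoin ℂ (Set.range (gen P)) : Set P.Universal)
  refine closure_mono ?_ (denseRange_mk P y)
  rintro _ ⟨x, rfl⟩
  exact h x

theorem _root_.continuous_starAlgHom {A B : Type} [CStarAlgebra A] [CStarAlgebra B]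
    (φ : A →⋆ₐ[ℂ] B) : Continuous φ :=
  AddMonoidHomClass.continuous_of_bound φ 1
    (fun x => by rw [one_mul]; exact NonUnitalStarAlgHom.norm_apply_le φ x)

/-- The universal property: a representation extends uniquely to a `*`-homomorphism. -/
theorem existsUnique_hom {B : Type} [CStarAlgebra B] {T : P.Gen → B} (hT : P.IsRep T) :
    ∃! φ : P.Universal →⋆ₐ[ℂ] B, ∀ g, φ (gen P g) = T g := by
  let e : P.Pre →+ B := (FreeStarAlg.eval T : FreeStarAlg P.Gen →+ B)
  have hunif : UniformContinuous e :=
    (AddMonoidHomClass.lipschitz_of_bound e 1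
      (fun x => by rw [one_mul]; exact P.le_universalNorm hT x)).uniformContinuous
  let f : P.Universal → B := Completion.extension e
  have hf : Continuous f := Completion.continuous_extension
  have hmk : ∀ x, f (mk P x) = FreeStarAlg.eval T x := fun x => Completion.extension_coe hunif x
  have hone : mk P 1 = 1 := Completion.coe_one P.Pre
  let φ : P.Universal →⋆ₐ[ℂ] B :=
    { toFun := f
      map_one' := by rw [← hone, hmk, map_one]
      map_zero' := by rw [← map_zero (mkHom P)]; exact (hmk 0).trans (map_zero _)
      map_mul' := fun x y => by
        refine (denseRange_mk P).induction_on₂ (p := fun x y => f (x * y) = f x * f y) ?_ ?_ x y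
        · exact isClosed_eq (hf.comp continuous_mul)
            ((hf.comp continuous_fst).mul (hf.comp continuous_snd))
        · intro x y
          rw [← mk_mul, hmk, hmk, hmk, map_mul]
      map_add' := fun x y => by
        refine (denseRange_mk P).induction_on₂ (p := fun x y => f (x + y) = f x + f y) ?_ ?_ x y
        · exact isClosed_eq (hf.comp continuous_add)
            ((hf.comp continuous_fst).add (hf.comp continuous_snd))
        · intro x y
          rw [← mk_add, hmk, hmk, hmk, map_add]
      commutes' := fun z => by
        rw [← AlgHomClass.commutes (mkHom P) z]
        exact (hmk _).trans (AlgHomClass.commutes _ z)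
      map_star' := fun x => by
        refine (denseRange_mk P).induction_on (p := fun x => f (star x) = star (f x)) x ?_ ?_
        · exact isClosed_eq (hf.comp (continuous_star' P)) hf.star
        · intro x
          rw [← mk_star, hmk, hmk, map_star] }
  refine ⟨φ, fun g => (hmk _).trans (FreeStarAlg.eval_gen T g), fun ψ hψ => ?_⟩
  refine DFunLike.coe_injective
    ((denseRange_mk P).equalizer (continuous_starAlgHom ψ) hf (funext fun x => ?_))
  change ψ (mkHom P x) = f (mk P x)
  rw [hmk]
  induction x using FreeStarAlg.induction with
  | scalar z => simp only [AlgHomClass.commutes]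
  | hgen g => rw [FreeStarAlg.eval_gen]; exact hψ g
  | hgenStar g =>
    rw [FreeStarAlg.eval_genStar, ← FreeStarAlg.star_gen, map_star, map_star]
    exact congrArg star (hψ g)
  | mul a b ha hb => rw [map_mul, map_mul, map_mul, ha, hb]
  | add a b ha hb => rw [map_add, map_add, map_add, ha, hb]

end Universal

end CStarPresentation

/-! ### Quantum permutation groups -/

/-- A quantum permutation group on `I`, recorded as the pair `(C(𝔾), u)`: a unital `C*`-algebra
`C(𝔾)` generated by the entries of a magic unitary `u`. As `u` generates, the comultiplication is
determined by `u` through `Δ (u i j) = ∑ k, u i k ⊗ u k j`, and a `*`-isomorphism that preserves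
the fundamental representations automatically intertwines the comultiplications. -/
structure QuantumPermGroup (I : Type) [Fintype I] where
  /-- The algebra `C(𝔾)`. -/
  Alg : Type
  [cstar : CStarAlgebra Alg]
  /-- The fundamental representation. -/
  u : I → I → Alg
  isStarProjection : ∀ i j, IsStarProjection (u i j)
  row_sum : ∀ i, ∑ k, u i k = 1
  col_sum : ∀ j, ∑ k, u k j = 1
  generates :
    (StarAlgebra.adjoin ℂ (Set.range fun p : I × I => u p.1 p.2)).topologicalClosure = ⊤

attribute [instance] QuantumPermGroup.cstar

/-- `𝔾 = ℍ` after renaming points along `e`: there is a `*`-isomorphism `C(𝔾) ≅ C(ℍ)` taking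
the fundamental representation of `𝔾` to that of `ℍ`. -/
def QuantumPermGroup.EqualVia {I J : Type} [Fintype I] [Fintype J] (e : I ≃ J)
    (G : QuantumPermGroup I) (H : QuantumPermGroup J) : Prop :=
  ∃ Φ : G.Alg ≃⋆ₐ[ℂ] H.Alg, ∀ i j, Φ (G.u i j) = H.u (e i) (e j)

/-- Equality `𝔾 = ℍ` of quantum permutation groups on the same set. -/
def QuantumPermGroup.Equal {I : Type} [Fintype I] (G H : QuantumPermGroup I) : Prop :=
  G.EqualVia (Equiv.refl I) H

theorem norm_le_one_of_isStarProjection {B : Type} [CStarAlgebra B] {p : B}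
    (hp : IsStarProjection p) : ‖p‖ ≤ 1 := by
  have h : ‖p‖ * ‖p‖ = ‖p‖ := by
    rw [← CStarRing.norm_star_mul_self, hp.isSelfAdjoint.star_eq, hp.isIdempotentElem.eq]
  nlinarith [norm_nonneg p]

section Magic

variable (I : Type) [Fintype I]

/-- The relations saying that the generators `u i j` form a magic unitary. -/
def magicRel : Set (FreeStarAlg (I × I)) :=
  {r | ∃ i j, r = FreeStarAlg.gen (i, j) * FreeStarAlg.gen (i, j) - FreeStarAlg.gen (i, j)} ∪
  {r | ∃ i j, r = star (FreeStarAlg.gen (i, j)) - FreeStarAlg.gen (i, j)} ∪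
  {r | ∃ i, r = ∑ k, FreeStarAlg.gen (i, k) - 1} ∪
  {r | ∃ j, r = ∑ k, FreeStarAlg.gen (k, j) - 1}

variable {I}

theorem isStarProjection_of_magicRel {B : Type} [CStarAlgebra B]
    (f : FreeStarAlg (I × I) →⋆ₐ[ℂ] B) (hf : ∀ r ∈ magicRel I, f r = 0) (i j : I) :
    IsStarProjection (f (FreeStarAlg.gen (i, j))) where
  isIdempotentElem := by
    have := hf _ (Or.inl (Or.inl (Or.inl ⟨i, j, rfl⟩)))
    rwa [map_sub, map_mul, sub_eq_zero] at this
  isSelfAdjoint := by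
    have := hf _ (Or.inl (Or.inl (Or.inr ⟨i, j, rfl⟩)))
    rwa [map_sub, map_star, sub_eq_zero] at this

theorem sum_eq_one_of_magicRel {B : Type} [CStarAlgebra B]
    (f : FreeStarAlg (I × I) →⋆ₐ[ℂ] B) (hf : ∀ r ∈ magicRel I, f r = 0) :
    (∀ i, ∑ k, f (FreeStarAlg.gen (i, k)) = 1) ∧ ∀ j, ∑ k, f (FreeStarAlg.gen (k, j)) = 1 := by
  refine ⟨fun i => ?_, fun j => ?_⟩
  · have := hf _ (Or.inl (Or.inr ⟨i, rfl⟩))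
    rwa [map_sub, map_one, map_sum, sub_eq_zero] at this
  · have := hf _ (Or.inr ⟨j, rfl⟩)
    rwa [map_sub, map_one, map_sum, sub_eq_zero] at this

/-- The presentation with generators `u i j`, the magic unitary relations and the additional
relations `R`. -/
abbrev magicPresentation (R : Set (FreeStarAlg (I × I))) : CStarPresentation where
  Gen := I × I
  Rel := magicRel I ∪ R
  bounded g := ⟨1, fun B _ T hT => by
    have := norm_le_one_of_isStarProjection (isStarProjection_of_magicRel (FreeStarAlg.eval T)
      (fun r hr => hT r (Or.inl hr)) g.1 g.2)
    rwa [FreeStarAlg.eval_gen] at this⟩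

/-- The universal `C*`-algebra generated by a magic unitary subject to the relations `R`. -/
abbrev QuantumPermGroup.ofRel (R : Set (FreeStarAlg (I × I))) : QuantumPermGroup I where
  Alg := (magicPresentation R).Universal
  u i j := CStarPresentation.Universal.gen (magicPresentation R) (i, j)
  isStarProjection := isStarProjection_of_magicRel
    (CStarPresentation.Universal.mkHom (magicPresentation R))
    (fun _ hr => CStarPresentation.Universal.mkHom_eq_zero (magicPresentation R) (Or.inl hr))
  row_sum := (sum_eq_one_of_magicRel
    (CStarPresentation.Universal.mkHom (magicPresentation R))
    (fun _ hr => CStarPresentation.Universal.mkHom_eq_zero (magicPresentation R) (Or.inl hr))).1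
  col_sum := (sum_eq_one_of_magicRel
    (CStarPresentation.Universal.mkHom (magicPresentation R))
    (fun _ hr => CStarPresentation.Universal.mkHom_eq_zero (magicPresentation R) (Or.inl hr))).2
  generates := CStarPresentation.Universal.adjoin_gen (magicPresentation R)

end Magic

/-- The quantum symmetric group `𝕊ₙ⁺`. -/
def quantumSymmetricGroup (n : ℕ) : QuantumPermGroup (Fin n) := QuantumPermGroup.ofRel ∅

/-- The quantum automorphism group of a graph: `u i j * u k l = 0` whenever exactly one of
`ik`, `jl` is an edge. -/
abbrev Qut {V : Type} [Fintype V] (X : SimpleGraph V) : QuantumPermGroup V :=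
  QuantumPermGroup.ofRel {r | ∃ i j k l, ¬(X.Adj i k ↔ X.Adj j l) ∧
    r = FreeStarAlg.gen (i, j) * FreeStarAlg.gen (k, l)}

/-! ### Free wreath products -/

section FreeWreath

/-- The relations saying that `ι : A → F` is a unital `*`-homomorphism. -/
def homRel {A F : Type} [CStarAlgebra A] [Ring F] [StarRing F] [Algebra ℂ F] (ι : A → F) :
    Set F :=
  {r | ∃ a b, r = ι (a + b) - (ι a + ι b)} ∪ {r | ∃ a b, r = ι (a * b) - ι a * ι b} ∪
  {r | ∃ (z : ℂ) (a : A), r = ι (z • a) - z • ι a} ∪ {r | ∃ a, r = ι (star a) - star (ι a)} ∪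
  {r | r = ι 1 - 1}

/-- A `*`-homomorphism killing `homRel ι` turns `ι` into a unital `*`-homomorphism. -/
def homOfHomRel {A G B : Type} [CStarAlgebra A] [CStarAlgebra B] (ι : A → FreeStarAlg G)
    (f : FreeStarAlg G →⋆ₐ[ℂ] B) (hf : ∀ r ∈ homRel ι, f r = 0) : A →⋆ₐ[ℂ] B :=
  have hsmul : ∀ (z : ℂ) (a : A), f (ι (z • a)) = z • f (ι a) := fun z a => by
    have := hf _ (Or.inl (Or.inl (Or.inr ⟨z, a, rfl⟩)))
    rwa [map_sub, map_smul, sub_eq_zero] at this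
  have hone : f (ι 1) = 1 := by
    have := hf _ (Or.inr rfl)
    rwa [map_sub, map_one, sub_eq_zero] at this
  { toFun := fun a => f (ι a)
    map_one' := hone
    map_mul' := fun a b => by
      have := hf _ (Or.inl (Or.inl (Or.inl (Or.inr ⟨a, b, rfl⟩))))
      rwa [map_sub, map_mul, sub_eq_zero] at this
    map_zero' := by
      have := hsmul 0 0
      rwa [zero_smul, zero_smul] at this
    map_add' := fun a b => by
      have := hf _ (Or.inl (Or.inl (Or.inl (Or.inl ⟨a, b, rfl⟩))))
      rwa [map_sub, map_add, sub_eq_zero] at this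
    commutes' := fun z => by
      rw [Algebra.algebraMap_eq_smul_one, hsmul, hone, Algebra.algebraMap_eq_smul_one]
    map_star' := fun a => by
      have := hf _ (Or.inl (Or.inr ⟨a, rfl⟩))
      rwa [map_sub, map_star, sub_eq_zero] at this }

variable {I J : Type} [Fintype I] [Fintype J]

/-- The `C*`-algebra of the free wreath product of `𝔾` (on `I`) by `ℍ` (on `J`): the unital free
product of copies `C(𝔾)⁽ᵃ⁾`, `a ∈ J`, of `C(𝔾)` and of `C(ℍ)`, modulo `[u⁽ᵃ⁾ i j, v a b] = 0`.
The generators are all elements of the copies of `C(𝔾)` and of `C(ℍ)`; the relations make the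
inclusions unital `*`-homomorphisms and impose the commutations. -/
abbrev wreathPresentation (G : QuantumPermGroup I) (H : QuantumPermGroup J) :
    CStarPresentation where
  Gen := (J × G.Alg) ⊕ H.Alg
  Rel := (⋃ a : J, homRel (fun x : G.Alg => FreeStarAlg.gen (Sum.inl (a, x)))) ∪
    homRel (fun y : H.Alg => FreeStarAlg.gen (Sum.inr y)) ∪
    {r | ∃ (i j : I) (a b : J),
      r = FreeStarAlg.gen (Sum.inl (a, G.u i j)) * FreeStarAlg.gen (Sum.inr (H.u a b)) -
        FreeStarAlg.gen (Sum.inr (H.u a b)) * FreeStarAlg.gen (Sum.inl (a, G.u i j))}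
  bounded g := by
    rcases g with ⟨a, x⟩ | y
    · refine ⟨‖x‖, fun B _ T hT => ?_⟩
      have := NonUnitalStarAlgHom.norm_apply_le (homOfHomRel _ (FreeStarAlg.eval T)
        (fun r hr => hT r (Or.inl (Or.inl (Set.mem_iUnion.2 ⟨a, hr⟩))))) x
      exact (congrArg norm (FreeStarAlg.eval_gen T (Sum.inl (a, x)))).symm.le.trans this
    · refine ⟨‖y‖, fun B _ T hT => ?_⟩
      have := NonUnitalStarAlgHom.norm_apply_le (homOfHomRel _ (FreeStarAlg.eval T)
        (fun r hr => hT r (Or.inl (Or.inr hr)))) y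
      exact (congrArg norm (FreeStarAlg.eval_gen T (Sum.inr y))).symm.le.trans this

variable (G : QuantumPermGroup I) (H : QuantumPermGroup J)

/-- The inclusion of the `a`-th copy of `C(𝔾)` into `C(𝔾 ≀⁎ ℍ)`. -/
def wreathInl (a : J) : G.Alg →⋆ₐ[ℂ] (wreathPresentation G H).Universal :=
  homOfHomRel (fun x : G.Alg => FreeStarAlg.gen (Sum.inl (a, x)))
    (CStarPresentation.Universal.mkHom (wreathPresentation G H))
    (fun _ hr => CStarPresentation.Universal.mkHom_eq_zero (wreathPresentation G H)
      (Or.inl (Or.inl (Set.mem_iUnion.2 ⟨a, hr⟩))))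

/-- The inclusion of `C(ℍ)` into `C(𝔾 ≀⁎ ℍ)`. -/
def wreathInr : H.Alg →⋆ₐ[ℂ] (wreathPresentation G H).Universal :=
  homOfHomRel (fun y : H.Alg => FreeStarAlg.gen (Sum.inr y))
    (CStarPresentation.Universal.mkHom (wreathPresentation G H))
    (fun _ hr => CStarPresentation.Universal.mkHom_eq_zero (wreathPresentation G H)
      (Or.inl (Or.inr hr)))

theorem wreath_commute (i j : I) (a b : J) :
    Commute (wreathInl G H a (G.u i j)) (wreathInr G H (H.u a b)) := by
  have key : ∀ (f : FreeStarAlg ((J × G.Alg) ⊕ H.Alg) →⋆ₐ[ℂ] (wreathPresentation G H).Universal)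
      (x y : FreeStarAlg ((J × G.Alg) ⊕ H.Alg)), f (x * y - y * x) = 0 → f x * f y = f y * f x := by
    intro f x y h
    rwa [map_sub, map_mul, map_mul, sub_eq_zero] at h
  exact key (CStarPresentation.Universal.mkHom (wreathPresentation G H)) _ _
    (CStarPresentation.Universal.mkHom_eq_zero (wreathPresentation G H)
      (Or.inr ⟨i, j, a, b, rfl⟩))

theorem wreath_generates [Nonempty I] :
    (StarAlgebra.adjoin ℂ (Set.range fun p : (J × I) × (J × I) =>
      wreathInl G H p.1.1 (G.u p.1.2 p.2.2) *
        wreathInr G H (H.u p.1.1 p.2.1))).topologicalClosure = ⊤ := by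
  set S := (StarAlgebra.adjoin ℂ (Set.range fun p : (J × I) × (J × I) =>
      wreathInl G H p.1.1 (G.u p.1.2 p.2.2) *
        wreathInr G H (H.u p.1.1 p.2.1))).topologicalClosure with hS
  have hclosed : IsClosed (S : Set (wreathPresentation G H).Universal) :=
    StarSubalgebra.isClosed_topologicalClosure _
  have hw : ∀ a b i j, wreathInl G H a (G.u i j) * wreathInr G H (H.u a b) ∈ S :=
    fun a b i j => StarSubalgebra.le_topologicalClosure _
      (StarAlgebra.subset_adjoin ℂ _ ⟨((a, i), (b, j)), rfl⟩)
  have hu : ∀ a i j, wreathInl G H a (G.u i j) ∈ S := fun a i j => by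
    have := sum_mem (fun b (_ : b ∈ Finset.univ) => hw a b i j)
    rwa [← Finset.mul_sum, ← map_sum, H.row_sum, map_one, mul_one] at this
  have hv : ∀ a b, wreathInr G H (H.u a b) ∈ S := fun a b => by
    obtain ⟨i⟩ := ‹Nonempty I›
    have := sum_mem (fun j (_ : j ∈ Finset.univ) => hw a b i j)
    rwa [← Finset.sum_mul, ← map_sum, G.row_sum, map_one, one_mul] at this
  have hl : ∀ a x, wreathInl G H a x ∈ S := fun a x => by
    have h : (StarAlgebra.adjoin ℂ
        (Set.range fun p : I × I => G.u p.1 p.2)).topologicalClosure ≤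
        S.comap (wreathInl G H a) :=
      StarSubalgebra.topologicalClosure_minimal
        (StarAlgebra.adjoin_le (by rintro _ ⟨p, rfl⟩; exact hu a p.1 p.2))
        (hclosed.preimage (continuous_starAlgHom (wreathInl G H a)))
    rw [G.generates] at h
    exact h (StarSubalgebra.mem_top (R := ℂ))
  have hr : ∀ y, wreathInr G H y ∈ S := fun y => by
    have h : (StarAlgebra.adjoin ℂ
        (Set.range fun p : J × J => H.u p.1 p.2)).topologicalClosure ≤
        S.comap (wreathInr G H) :=
      StarSubalgebra.topologicalClosure_minimal
        (StarAlgebra.adjoin_le (by rintro _ ⟨p, rfl⟩; exact hv p.1 p.2))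
        (hclosed.preimage (continuous_starAlgHom (wreathInr G H)))
    rw [H.generates] at h
    exact h (StarSubalgebra.mem_top (R := ℂ))
  refine top_le_iff.mp ?_
  rw [← CStarPresentation.Universal.adjoin_gen (wreathPresentation G H)]
  refine StarSubalgebra.topologicalClosure_minimal (StarAlgebra.adjoin_le ?_) hclosed
  rintro _ ⟨⟨a, x⟩ | y, rfl⟩
  · exact hl a x
  · exact hr y

/-- The free wreath product `𝔾 ≀⁎ ℍ`, with fundamental representation
`w (a, i) (b, j) = u⁽ᵃ⁾ i j * v a b`. -/
def QuantumPermGroup.freeWreath [Nonempty I] : QuantumPermGroup (J × I) where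
  Alg := (wreathPresentation G H).Universal
  u p q := wreathInl G H p.1 (G.u p.2 q.2) * wreathInr G H (H.u p.1 q.1)
  isStarProjection p q := by
    have hu := (G.isStarProjection p.2 q.2).map (wreathInl G H p.1)
    have hv := (H.isStarProjection p.1 q.1).map (wreathInr G H)
    exact hu.mul hv (wreath_commute G H p.2 q.2 p.1 q.1)
  row_sum p := by
    simp_rw [Fintype.sum_prod_type, ← Finset.sum_mul, ← map_sum, G.row_sum, map_one, one_mul,
      ← map_sum, H.row_sum, map_one]
  col_sum q := by
    simp_rw [Fintype.sum_prod_type, ← Finset.sum_mul, ← map_sum, G.col_sum, map_one, one_mul,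
      ← map_sum, H.col_sum, map_one]
  generates := wreath_generates G H

end FreeWreath

/-! ### Graphs -/

/-- The lexicographic product `X[Y]`. -/
def lexProduct {V W : Type} (X : SimpleGraph V) (Y : SimpleGraph W) : SimpleGraph (V × W) where
  Adj p q := X.Adj p.1 q.1 ∨ (p.1 = q.1 ∧ Y.Adj p.2 q.2)
  symm := ⟨fun _ _ h => h.imp (fun h => h.symm) (fun h => ⟨h.1.symm, h.2.symm⟩)⟩
  loopless := ⟨fun _ h => h.elim (fun h => X.irrefl h) (fun h => Y.irrefl h.2)⟩

/-- `Aut(X)` has a single orbit on vertices. -/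
def IsVertexTransitive {V : Type} (X : SimpleGraph V) : Prop :=
  ∀ x x' : V, ∃ φ : X ≃g X, φ x = x'

/-- `Qut(X)` has a single orbit on vertices. -/
def IsQuantumVertexTransitive {V : Type} [Fintype V] (X : SimpleGraph V) : Prop :=
  ∀ x x' : V, (Qut X).u x x' ≠ 0

/-- `X = X'[K]` for some quantum vertex-transitive graph `X'`. -/
def HasOuterFactor {V U : Type} (X : SimpleGraph V) (K : SimpleGraph U) : Prop :=
  ∃ (V' : Type) (_ : Fintype V') (X' : SimpleGraph V'),
    IsQuantumVertexTransitive X' ∧ Nonempty (X ≃g lexProduct X' K)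

/-- `Y = K[Y']` for some finite vertex-transitive graph `Y'`. -/
def HasInnerFactor {W U : Type} (Y : SimpleGraph W) (K : SimpleGraph U) : Prop :=
  ∃ (W' : Type) (_ : Finite W') (Y' : SimpleGraph W'),
    IsVertexTransitive Y' ∧ Nonempty (Y ≃g lexProduct K Y')

/-- Given bijections `V ≃ V' × Fin m` and `W ≃ Fin n × W'`, the bijection
`V × W ≃ V' × (Fin (m * n) × W')` that merges the two middle factors. -/
def mergeEquiv {V W V' W' : Type} {m n : ℕ} (e : V ≃ V' × Fin m) (f : W ≃ Fin n × W') :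
    V × W ≃ V' × (Fin (m * n) × W') :=
  (e.prodCongr f).trans <| (Equiv.prodAssoc V' (Fin m) (Fin n × W')).trans <|
    (Equiv.refl V').prodCongr <| (Equiv.prodAssoc (Fin m) (Fin n) W').symm.trans <|
      finProdFinEquiv.prodCongr (Equiv.refl W')

end

/-! Everything rests on invariance of the fibres of `X[Y]` over `X`. If a magic unitary respects
"same fibre", it splits into a magic unitary on `X` (how blocks move) and one on `Y` for each fibre
(how points move inside it). These satisfy exactly the relations of the free wreath product, so
invariant fibres give `Qut(X[Y]) = Qut(Y) ≀⁎ Qut(X)` (`qut_lexProduct_equal_freeWreath`).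

Invariance is proved by defining the fibres combinatorially. A magic unitary that respects adjacency
respects every relation obtained from it by Boolean operations, by counting two-step paths
(`Preserves.ncard`) and by reflexive transitive closure (`Preserves.reflTransGen`). A quantum
vertex-transitive graph is regular, and in a regular graph twins are recognised by their number of
common neighbours. If `X` is also twin-free, non-adjacent points of `X[Y]` share a fibre exactly
when they have at least `k * |W|` common neighbours, `k` being the degree of `X`
(`lexProduct_fibre_iff`). The missing pairs come from connectedness of `Yᶜ`, or from the same
argument in the complement.

Hence equality can fail only if `X` has twins and `Y` is disconnected, or the same holds for the
complements. In the first case the twin classes of `X` all have one size and the components of `Y`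
are all isomorphic; the class size and the number of components are the maximal `α` and `β`. For
maximal values `X'` is twin-free and `Y'` is connected. Then `X[Y] ≅ X'[K̄_αβ[Y']]`, and the fibre
criterion applies twice: to the outer product because the complement of `K̄_αβ[Y']` is connected, to
the inner one because `Y'` is connected. The second case follows by complementation, which changes
no quantum automorphism group. -/

open Finset

/-! ### Magic unitaries and their invariant relations -/

section MagicUnitary

variable {I B S T : Type} [CStarAlgebra B]

/-- A magic unitary: a matrix of projections whose rows and columns sum to `1`. -/
structure IsMagicUnitary [Fintype I] (u : I → I → B) : Prop where
  isStarProjection : ∀ i j, IsStarProjection (u i j)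
  row_sum : ∀ i, ∑ k, u i k = 1
  col_sum : ∀ j, ∑ k, u k j = 1

/-- Projections that sum to `1` are pairwise orthogonal. -/
theorem mul_eq_zero_of_sum_eq_one [Fintype I] {p : I → B} (hp : ∀ i, IsStarProjection (p i))
    (hsum : ∑ i, p i = 1) {i j : I} (hij : i ≠ j) : p i * p j = 0 := by
  classical
  let _ := CStarAlgebra.spectralOrder B
  have _ := CStarAlgebra.spectralOrderedRing B
  -- The term `k = j` already equals `p j`, so the other terms, all positive, sum to zero and each
  -- vanishes.
  have h1 : ∑ k, star (p k * p j) * (p k * p j) = p j := by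
    calc _ = p j * (∑ k, p k) * p j := by
          rw [mul_sum, sum_mul]
          refine sum_congr rfl fun k _ => ?_
          rw [star_mul, (hp j).isSelfAdjoint.star_eq, (hp k).isSelfAdjoint.star_eq,
            mul_assoc (p j), ← mul_assoc (p k), (hp k).isIdempotentElem.eq, mul_assoc]
      _ = p j := by rw [hsum, mul_one, (hp j).isIdempotentElem.eq]
  rw [← add_sum_erase _ _ (mem_univ j), (hp j).isIdempotentElem.eq,
    (hp j).isSelfAdjoint.star_eq, (hp j).isIdempotentElem.eq, add_eq_left,
    sum_eq_zero_iff_of_nonneg fun k _ => star_mul_self_nonneg _] at h1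
  exact CStarRing.star_mul_self_eq_zero_iff _ |>.1 (h1 i (mem_erase.2 ⟨hij, mem_univ i⟩))

/-- A sum of pairwise orthogonal projections is a projection. -/
theorem IsStarProjection.sum {ι : Type} {p : ι → B} (s : Finset ι)
    (hp : ∀ i ∈ s, IsStarProjection (p i)) (h : ∀ i ∈ s, ∀ j ∈ s, i ≠ j → p i * p j = 0) :
    IsStarProjection (∑ i ∈ s, p i) where
  isIdempotentElem := by
    rw [IsIdempotentElem, sum_mul_sum]
    refine sum_congr rfl fun i hi => ?_
    rw [sum_eq_single_of_mem i hi fun j hj hji => h i hi j hj hji.symm]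
    exact (hp i hi).isIdempotentElem.eq
  isSelfAdjoint := by
    rw [IsSelfAdjoint, star_sum]
    exact sum_congr rfl fun i hi => (hp i hi).isSelfAdjoint.star_eq

namespace IsMagicUnitary

variable [Fintype I] {u : I → I → B} (hu : IsMagicUnitary u)

include hu

theorem mul_self (i j : I) : u i j * u i j = u i j :=
  (hu.isStarProjection i j).isIdempotentElem.eq

theorem row_mul {i j l : I} (h : j ≠ l) : u i j * u i l = 0 :=
  mul_eq_zero_of_sum_eq_one (hu.isStarProjection i) (hu.row_sum i) h

theorem col_mul {i k j : I} (h : i ≠ k) : u i j * u k j = 0 :=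
  mul_eq_zero_of_sum_eq_one (fun i => hu.isStarProjection i j) (hu.col_sum j) h

theorem transpose : IsMagicUnitary fun i j => u j i where
  isStarProjection i j := hu.isStarProjection j i
  row_sum := hu.col_sum
  col_sum := hu.row_sum

end IsMagicUnitary

/-- The colouring `c` of pairs is invariant under the matrix `u`. -/
def Preserves (u : I → I → B) (c : I → I → S) : Prop :=
  ∀ i j k l, c i k ≠ c j l → u i j * u k l = 0

namespace Preserves

variable {u : I → I → B} {c : I → I → S} {d : I → I → T}

theorem map (hc : Preserves u c) (f : S → T) : Preserves u fun i k => f (c i k) :=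
  fun i j k l h => hc i j k l fun h' => h (congrArg f h')

theorem prod (hc : Preserves u c) (hd : Preserves u d) : Preserves u fun i k => (c i k, d i k) :=
  fun i j k l h => by
    by_cases h1 : c i k = c j l
    · exact hd i j k l fun h2 => h (Prod.ext h1 h2)
    · exact hc i j k l h1

theorem const (s : S) : Preserves u fun _ _ => s := fun _ _ _ _ h => absurd rfl h

/-- Covers Boolean combinations of invariant relations and thresholds on invariant counts. -/
theorem map₂ {U : Type} (hc : Preserves u c) (hd : Preserves u d) (f : S → T → U) :
    Preserves u fun i k => f (c i k) (d i k) :=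
  (hc.prod hd).map fun p => f p.1 p.2

theorem transpose (hc : Preserves u c) : Preserves (fun i j => u j i) c :=
  fun i j k l h => hc j i l k h.symm

variable [Fintype I]

/-- This is orthogonality of the entries within each row and each column. -/
theorem eq (hu : IsMagicUnitary u) : Preserves u fun i k => i = k := fun i j k l h => by
  by_cases h1 : i = k
  · subst h1
    exact hu.row_mul fun h2 => h (propext ⟨fun _ => h2, fun _ => rfl⟩)
  · by_cases h2 : j = l
    · subst h2
      exact hu.col_mul h1
    · exact absurd (propext ⟨fun h => absurd h h1, fun h => absurd h h2⟩) h

/-- The number of two-step paths with prescribed colours is invariant. -/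
theorem ncard (hu : IsMagicUnitary u) {R R' : I → I → Prop} (hR : Preserves u R)
    (hR' : Preserves u R') : Preserves u fun i k => {m | R i m ∧ R' m k}.ncard := by
  classical
  intro i j k l h
  -- Where the two conditions differ, the triple product vanishes. The constraint can therefore be
  -- read at the row indices or at the column indices. Summing over `p` first then counts paths from
  -- `i` to `k`, summing over `m` first counts paths from `j` to `l`.
  have h1 : ∀ m p, (if R i m ∧ R' m k then u i j * u m p * u k l else 0) =
      if R j p ∧ R' p l then u i j * u m p * u k l else 0 := by
    intro m p
    by_cases h1 : R i m = R j p
    · by_cases h2 : R' m k = R' p l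
      · simp only [h1, h2]
      · rw [mul_assoc, hR' m p k l h2, mul_zero, ite_self, ite_self]
    · rw [hR i j m p h1, zero_mul, ite_self, ite_self]
  have h2 : {m | R i m ∧ R' m k}.ncard • (u i j * u k l) =
      ∑ m, ∑ p, if R i m ∧ R' m k then u i j * u m p * u k l else 0 := by
    rw [Set.ncard_eq_toFinset_card', Set.toFinset_ofPred, ← sum_const, sum_filter]
    refine sum_congr rfl fun m _ => ?_
    split_ifs
    · rw [← sum_mul, ← mul_sum, hu.row_sum, mul_one]
    · rw [sum_const_zero]
  have h3 : {m | R j m ∧ R' m l}.ncard • (u i j * u k l) =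
      ∑ m, ∑ p, if R j p ∧ R' p l then u i j * u m p * u k l else 0 := by
    rw [Set.ncard_eq_toFinset_card', Set.toFinset_ofPred, ← sum_const, sum_filter, sum_comm]
    refine sum_congr rfl fun m _ => ?_
    split_ifs
    · rw [← sum_mul, ← mul_sum, hu.col_sum, mul_one]
    · rw [sum_const_zero]
  simp_rw [h1, ← h3, ← Nat.cast_smul_eq_nsmul ℂ] at h2
  -- A non-zero element has distinct multiples by distinct natural numbers, since `B` is a complex
  -- vector space.
  by_contra h0
  exact h (Nat.cast_injective (smul_left_injective ℂ h0 h2))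

/-- The number of points in a given relation to a point is invariant. -/
theorem ncard_right (hu : IsMagicUnitary u) {R : I → I → Prop} (hR : Preserves u R) {i j : I}
    (h : u i j ≠ 0) : {m | R i m}.ncard = {m | R j m}.ncard := by
  -- With an unrestricted second step, the paths from `i` to `i` number as many as the points
  -- related to `i`.
  have h1 := ncard hu hR (const (u := u) True)
  simp only [and_true] at h1
  by_contra h2
  apply h
  rw [← hu.mul_self]
  exact h1 i j i j h2

/-- Insert `1 = ∑ p, u m p` at the last intermediate point `m` of a chain from `i` to `k`. If `p` is
reachable from `j`, then `p` is not related to `l` and the second product vanishes; otherwise the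
first does, by induction. -/
theorem reflTransGen (hu : IsMagicUnitary u) {R : I → I → Prop} (hR : Preserves u R) :
    Preserves u (Relation.ReflTransGen R) := by
  -- The argument is one-sided; stating it for every `v` lets the transpose of `u` supply the other
  -- side.
  have key : ∀ {v : I → I → B}, IsMagicUnitary v → Preserves v R → ∀ i j k l,
      Relation.ReflTransGen R i k → ¬ Relation.ReflTransGen R j l → v i j * v k l = 0 := by
    intro v hv hR i j k l h
    induction h generalizing l with
    | refl => exact fun hl => hv.row_mul fun h => hl (h ▸ .refl)
    | @tail m k _ hmk ih =>
      intro hl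
      rw [← mul_one (v i j), ← hv.row_sum m, mul_sum, sum_mul]
      refine sum_eq_zero fun p _ => ?_
      by_cases hp : Relation.ReflTransGen R j p
      · rw [mul_assoc, hR m p k l fun h => hl (hp.tail (h ▸ hmk)), mul_zero]
      · rw [ih p hp, zero_mul]
  intro i j k l h
  by_cases h1 : Relation.ReflTransGen R i k
  · exact key hu hR i j k l h1 fun h2 => h (propext ⟨fun _ => h2, fun _ => h1⟩)
  · by_cases h2 : Relation.ReflTransGen R j l
    · exact key hu.transpose hR.transpose j i l k h2 h1
    · exact absurd (propext ⟨fun h => absurd h h1, fun h => absurd h h2⟩) h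

end Preserves

end MagicUnitary

/-! ### Equality of quantum permutation groups -/

namespace QuantumPermGroup

variable {I J K : Type} [Fintype I] [Fintype J] [Fintype K]

theorem isMagicUnitary (G : QuantumPermGroup I) : IsMagicUnitary G.u where
  isStarProjection := G.isStarProjection
  row_sum := G.row_sum
  col_sum := G.col_sum

theorem hom_ext {G : QuantumPermGroup I} {B : Type} [CStarAlgebra B] {f g : G.Alg →⋆ₐ[ℂ] B}
    (h : ∀ i j, f (G.u i j) = g (G.u i j)) : f = g := by
  have h1 : (StarAlgebra.adjoin ℂ
      (Set.range fun p : I × I => G.u p.1 p.2)).topologicalClosure ≤ StarAlgHom.equalizer f g :=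
    StarSubalgebra.topologicalClosure_minimal
      (StarAlgebra.adjoin_le (by rintro _ ⟨p, rfl⟩; exact h p.1 p.2))
      (isClosed_eq (continuous_starAlgHom f) (continuous_starAlgHom g))
  rw [G.generates] at h1
  exact StarAlgHom.ext fun x => h1 (StarSubalgebra.mem_top (R := ℂ))

theorem equalVia_of_homs {G : QuantumPermGroup I} {H : QuantumPermGroup J} {e : I ≃ J}
    (f : G.Alg →⋆ₐ[ℂ] H.Alg) (g : H.Alg →⋆ₐ[ℂ] G.Alg)
    (hf : ∀ i j, f (G.u i j) = H.u (e i) (e j)) (hg : ∀ i j, g (H.u (e i) (e j)) = G.u i j) :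
    G.EqualVia e H := by
  refine ⟨StarAlgEquiv.ofStarAlgHom f g ?_ ?_, hf⟩
  · exact hom_ext fun i j => by
      simp [hf, hg]
  · exact hom_ext fun i j => by
      obtain ⟨i, rfl⟩ := e.surjective i
      obtain ⟨j, rfl⟩ := e.surjective j
      simp [hf, hg]

theorem Equal.refl (G : QuantumPermGroup I) : G.Equal G := ⟨StarAlgEquiv.refl _ _, fun _ _ => rfl⟩

theorem EqualVia.symm {G : QuantumPermGroup I} {H : QuantumPermGroup J} {e : I ≃ J}
    (h : G.EqualVia e H) : H.EqualVia e.symm G := by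
  obtain ⟨Φ, hΦ⟩ := h
  exact ⟨Φ.symm, fun i j => by rw [← Φ.symm_apply_apply (G.u _ _), hΦ]; simp⟩

theorem EqualVia.trans {G : QuantumPermGroup I} {H : QuantumPermGroup J}
    {L : QuantumPermGroup K} {e : I ≃ J} {f : J ≃ K} (h : G.EqualVia e H)
    (h' : H.EqualVia f L) : G.EqualVia (e.trans f) L := by
  obtain ⟨Φ, hΦ⟩ := h
  obtain ⟨Ψ, hΨ⟩ := h'
  exact ⟨Φ.trans Ψ, fun i j => by simp [hΦ, hΨ]⟩

theorem Equal.symm {G H : QuantumPermGroup I} (h : G.Equal H) : H.Equal G := EqualVia.symm h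

theorem Equal.trans {G H L : QuantumPermGroup I} (h : G.Equal H) (h' : H.Equal L) : G.Equal L :=
  EqualVia.trans h h'

end QuantumPermGroup

/-! ### Universal property of quantum automorphism groups -/

section Qut

variable {V W : Type} [Fintype V] [Fintype W]

/-- The universal property of `Qut X`. -/
theorem exists_qut_hom {X : SimpleGraph V} {B : Type} [CStarAlgebra B] {u : V → V → B}
    (hu : IsMagicUnitary u) (h : Preserves u X.Adj) :
    ∃ f : (Qut X).Alg →⋆ₐ[ℂ] B, ∀ i j, f ((Qut X).u i j) = u i j := by
  obtain ⟨f, hf, -⟩ := CStarPresentation.Universal.existsUnique_hom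
    (magicPresentation {r | ∃ i j k l, ¬(X.Adj i k ↔ X.Adj j l) ∧
      r = FreeStarAlg.gen (i, j) * FreeStarAlg.gen (k, l)}) (B := B) (T := fun p => u p.1 p.2) (by
    rintro _ ((((⟨i, j, rfl⟩ | ⟨i, j, rfl⟩) | ⟨i, rfl⟩) | ⟨j, rfl⟩) | ⟨i, j, k, l, hr, rfl⟩)
    · rw [map_sub, map_mul, FreeStarAlg.eval_gen, hu.mul_self, sub_self]
    · rw [map_sub, map_star, FreeStarAlg.eval_gen,
        (hu.isStarProjection i j).isSelfAdjoint.star_eq, sub_self]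
    · simp_rw [map_sub, map_sum, map_one, FreeStarAlg.eval_gen, hu.row_sum, sub_self]
    · simp_rw [map_sub, map_sum, map_one, FreeStarAlg.eval_gen, hu.col_sum, sub_self]
    · rw [map_mul, FreeStarAlg.eval_gen, FreeStarAlg.eval_gen]
      exact h i j k l fun h' => hr (iff_of_eq h'))
  exact ⟨f, fun i j => hf (i, j)⟩

theorem qut_preserves (X : SimpleGraph V) : Preserves (Qut X).u X.Adj := fun i j k l h => by
  have h1 := CStarPresentation.Universal.mkHom_eq_zero
    (magicPresentation {r | ∃ i j k l, ¬(X.Adj i k ↔ X.Adj j l) ∧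
      r = FreeStarAlg.gen (i, j) * FreeStarAlg.gen (k, l)})
    (Or.inr ⟨i, j, k, l, fun h' => h (propext h'), rfl⟩)
  exact (map_mul _ _ _).symm.trans h1

theorem Preserves.compl {B : Type} [CStarAlgebra B] {u : V → V → B} (hu : IsMagicUnitary u)
    {X : SimpleGraph V} (h : Preserves u X.Adj) : Preserves u Xᶜ.Adj :=
  (Preserves.eq hu).map₂ h fun p q => ¬ p ∧ ¬ q

/-- The two universal properties give mutually inverse homomorphisms on generators. -/
theorem qut_equal_of_preserves {X : SimpleGraph V} {Y : SimpleGraph V}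
    (h : Preserves (Qut X).u Y.Adj) (h' : Preserves (Qut Y).u X.Adj) :
    (Qut X).Equal (Qut Y) := by
  obtain ⟨f, hf⟩ := exists_qut_hom (Qut Y).isMagicUnitary h'
  obtain ⟨g, hg⟩ := exists_qut_hom (Qut X).isMagicUnitary h
  exact QuantumPermGroup.equalVia_of_homs f g hf hg

theorem qut_equal_compl (X : SimpleGraph V) : (Qut X).Equal (Qut Xᶜ) :=
  qut_equal_of_preserves (.compl (Qut X).isMagicUnitary (qut_preserves X)) <| by
    have h := Preserves.compl (Qut Xᶜ).isMagicUnitary (qut_preserves Xᶜ)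
    rwa [compl_compl] at h

theorem IsMagicUnitary.reindex {B : Type} [CStarAlgebra B] {u : W → W → B}
    (hu : IsMagicUnitary u) (e : V ≃ W) : IsMagicUnitary fun i j => u (e i) (e j) where
  isStarProjection _ _ := hu.isStarProjection _ _
  row_sum i := (e.sum_comp (u (e i))).trans (hu.row_sum _)
  col_sum j := (e.sum_comp fun k => u k (e j)).trans (hu.col_sum _)

theorem qut_equalVia_of_iso {X : SimpleGraph V} {Y : SimpleGraph W} (φ : X ≃g Y) :
    (Qut X).EqualVia φ.toEquiv (Qut Y) := by
  have key : ∀ {V W : Type} [Fintype V] [Fintype W] {X : SimpleGraph V} {Y : SimpleGraph W}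
      (φ : X ≃g Y), ∃ f : (Qut X).Alg →⋆ₐ[ℂ] (Qut Y).Alg,
        ∀ i j, f ((Qut X).u i j) = (Qut Y).u (φ.toEquiv i) (φ.toEquiv j) := by
    intro V W _ _ X Y φ
    refine exists_qut_hom ((Qut Y).isMagicUnitary.reindex φ.toEquiv) fun _ _ _ _ h =>
      qut_preserves Y _ _ _ _ fun h' => h ?_
    exact propext ((φ.map_adj_iff).symm.trans ((iff_of_eq h').trans φ.map_adj_iff))
  obtain ⟨f, hf⟩ := key φ
  obtain ⟨g, hg⟩ := key φ.symm
  refine QuantumPermGroup.equalVia_of_homs f g hf fun i j => ?_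
  rw [hg]
  exact congrArg₂ _ (φ.symm_apply_apply i) (φ.symm_apply_apply j)

end Qut

/-! ### Universal property of free wreath products -/

section Wreath

variable {I J : Type} [Fintype I] [Fintype J]

theorem eval_eq_zero_of_mem_homRel {A G B : Type} [CStarAlgebra A] [CStarAlgebra B]
    {ι : A → FreeStarAlg G} {T : G → B} (f : A →⋆ₐ[ℂ] B)
    (h : ∀ x, FreeStarAlg.eval T (ι x) = f x) {r : FreeStarAlg G} (hr : r ∈ homRel ι) :
    FreeStarAlg.eval T r = 0 := by
  rcases hr with ((((⟨a, b, rfl⟩ | ⟨a, b, rfl⟩) | ⟨z, a, rfl⟩) | ⟨a, rfl⟩) | rfl)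
  · simp only [map_sub, map_add, h, sub_self]
  · simp only [map_sub, map_mul, h, sub_self]
  · simp only [map_sub, map_smul, h, sub_self]
  · simp only [map_sub, map_star, h, sub_self]
  · simp only [map_sub, map_one, h, sub_self]

/-- The universal property of the free wreath product. -/
theorem exists_wreath_hom [Nonempty I] (G : QuantumPermGroup I) (H : QuantumPermGroup J)
    {B : Type} [CStarAlgebra B] (f : J → G.Alg →⋆ₐ[ℂ] B) (g : H.Alg →⋆ₐ[ℂ] B)
    (hfg : ∀ i j a b, Commute (f a (G.u i j)) (g (H.u a b))) :
    ∃ F : (G.freeWreath H).Alg →⋆ₐ[ℂ] B, ∀ p q,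
      F ((G.freeWreath H).u p q) = f p.1 (G.u p.2 q.2) * g (H.u p.1 q.1) := by
  obtain ⟨F, hF, -⟩ := CStarPresentation.Universal.existsUnique_hom (wreathPresentation G H)
    (B := B) (T := Sum.elim (fun p => f p.1 p.2) g) (by
      rintro r ((hr | hr) | ⟨i, j, a, b, rfl⟩)
      · obtain ⟨a, ha⟩ := Set.mem_iUnion.1 hr
        exact eval_eq_zero_of_mem_homRel (f a) (fun x => FreeStarAlg.eval_gen _ (Sum.inl (a, x))) ha
      · exact eval_eq_zero_of_mem_homRel g (fun x => FreeStarAlg.eval_gen _ (Sum.inr x)) hr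
      · simp only [map_sub, map_mul, FreeStarAlg.eval_gen]
        exact sub_eq_zero.2 (hfg i j a b))
  refine ⟨F, fun p q => (map_mul F _ _).trans ?_⟩
  exact congrArg₂ _ (hF (Sum.inl (p.1, G.u p.2 q.2))) (hF (Sum.inr (H.u p.1 q.1)))

theorem QuantumPermGroup.Equal.freeWreath [Nonempty I] {G G' : QuantumPermGroup I}
    {H H' : QuantumPermGroup J} (hG : G.Equal G') (hH : H.Equal H') :
    (G.freeWreath H).Equal (G'.freeWreath H') := by
  have key : ∀ {G G' : QuantumPermGroup I} {H H' : QuantumPermGroup J}, G.Equal G' → H.Equal H' →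
      ∃ F : (G.freeWreath H).Alg →⋆ₐ[ℂ] (G'.freeWreath H').Alg, ∀ p q,
        F ((G.freeWreath H).u p q) = (G'.freeWreath H').u p q := by
    rintro G G' H H' ⟨Φ, hΦ⟩ ⟨Ψ, hΨ⟩
    have h1 : ∀ a i j, ((wreathInl G' H' a).comp (Φ : G.Alg →⋆ₐ[ℂ] G'.Alg)) (G.u i j) =
        wreathInl G' H' a (G'.u i j) := fun a i j => congrArg (wreathInl G' H' a) (hΦ i j)
    have h2 : ∀ a b, ((wreathInr G' H').comp (Ψ : H.Alg →⋆ₐ[ℂ] H'.Alg)) (H.u a b) =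
        wreathInr G' H' (H'.u a b) := fun a b => congrArg (wreathInr G' H') (hΨ a b)
    obtain ⟨F, hF⟩ := exists_wreath_hom G H
      (fun a => (wreathInl G' H' a).comp (Φ : G.Alg →⋆ₐ[ℂ] G'.Alg))
      ((wreathInr G' H').comp (Ψ : H.Alg →⋆ₐ[ℂ] H'.Alg)) (fun i j a b => by
        rw [h1, h2]
        exact wreath_commute G' H' i j a b)
    exact ⟨F, fun p q => (hF p q).trans (congrArg₂ _ (h1 _ _ _) (h2 _ _))⟩
  obtain ⟨f, hf⟩ := key hG hH
  obtain ⟨g, hg⟩ := key hG.symm hH.symm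
  exact QuantumPermGroup.equalVia_of_homs f g hf hg

end Wreath

/-! ### Invariant fibres give a free wreath product -/

section Blocks

variable {V W B : Type} [Fintype V] [Fintype W] [CStarAlgebra B] {u : V × W → V × W → B}

omit [Fintype V] in
theorem block_mul_eq_zero (hF : Preserves u fun p q => p.1 = q.1) {x x' x'' : V} (y z : W)
    (h : x' ≠ x'') : (∑ y', u (x, y) (x', y')) * ∑ y', u (x, z) (x'', y') = 0 := by
  rw [sum_mul_sum]
  refine sum_eq_zero fun a _ => sum_eq_zero fun b _ => hF _ _ _ _ ?_
  simpa using h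

/-- Each side equals the product of the two: multiply by the full row sum at the other point, where
fibre invariance kills every block except the one over `x'`. -/
theorem block_eq (hu : IsMagicUnitary u) (hF : Preserves u fun p q => p.1 = q.1) (x x' : V)
    (y z : W) : ∑ y', u (x, y) (x', y') = ∑ y', u (x, z) (x', y') := by
  have h1 : (∑ y', u (x, y) (x', y')) * ∑ y', u (x, z) (x', y') = ∑ y', u (x, y) (x', y') := by
    conv_rhs => rw [← mul_one (∑ y', u (x, y) (x', y')), ← hu.row_sum (x, z),
      Fintype.sum_prod_type, mul_sum]
    rw [Fintype.sum_eq_single x' fun x'' h => block_mul_eq_zero hF y z h.symm]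
  have h2 : (∑ y', u (x, y) (x', y')) * ∑ y', u (x, z) (x', y') = ∑ y', u (x, z) (x', y') := by
    conv_rhs => rw [← one_mul (∑ y', u (x, z) (x', y')), ← hu.row_sum (x, y),
      Fintype.sum_prod_type, sum_mul]
    rw [Fintype.sum_eq_single x' fun x'' h => block_mul_eq_zero hF y z h]
  exact h1.symm.trans h2

/-- If the fibres of `V × W → V` are invariant, then `u` induces a magic unitary on `V`. -/
theorem exists_block [Nonempty W] (hu : IsMagicUnitary u)
    (hF : Preserves u fun p q => p.1 = q.1) : ∃ p : V → V → B, IsMagicUnitary p ∧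
      (∀ x x' y, ∑ y', u (x, y) (x', y') = p x x') ∧
      ∀ x x' y', ∑ y, u (x, y) (x', y') = p x x' := by
  obtain ⟨w⟩ := ‹Nonempty W›
  have hrow : ∀ x x' y, ∑ y', u (x, y) (x', y') = ∑ y', u (x, w) (x', y') :=
    fun x x' y => block_eq hu hF x x' y w
  have hcol : ∀ x x' y', ∑ y, u (x, y) (x', y') = ∑ y', u (x, w) (x', y') := by
    intro x x' y'
    -- Summing the whole block both ways gives `|W|` times a row sum and `|W|` times a column sum;
    -- `|W|` is non-zero and cancels.
    have h1 := sum_comm (s := (univ : Finset W)) (t := (univ : Finset W))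
      (f := fun y y' => u (x, y) (x', y'))
    simp_rw [hrow, block_eq hu.transpose hF.transpose x' x _ y', sum_const, card_univ,
      ← Nat.cast_smul_eq_nsmul ℂ] at h1
    exact (smul_right_injective B
      (Nat.cast_ne_zero.2 (Fintype.card_pos_iff.2 ⟨w⟩).ne') h1).symm
  refine ⟨fun x x' => ∑ y', u (x, w) (x', y'), ⟨fun x x' => ?_, fun x => ?_, fun x' => ?_⟩,
    hrow, hcol⟩
  · exact IsStarProjection.sum _ (fun _ _ => hu.isStarProjection _ _)
      fun a _ b _ h => hu.row_mul fun h' => h (congrArg Prod.snd h')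
  · rw [← Fintype.sum_prod_type, hu.row_sum]
  · simp_rw [← hcol _ _ w]
    rw [← Fintype.sum_prod_type fun p => u p (x', w), hu.col_sum]

variable {X : SimpleGraph V} {Y : SimpleGraph W}

omit [Fintype V] in
theorem preserves_block [Nonempty W] (hL : Preserves u (lexProduct X Y).Adj)
    (hF : Preserves u fun p q => p.1 = q.1) {p : V → V → B}
    (hp : ∀ x x' y, ∑ y', u (x, y) (x', y') = p x x') : Preserves p X.Adj := by
  intro x x' a a' h
  obtain ⟨w⟩ := ‹Nonempty W›
  rw [← hp x x' w, ← hp a a' w, sum_mul_sum]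
  refine sum_eq_zero fun y _ => sum_eq_zero fun z _ => ?_
  by_cases h1 : (x = a) = (x' = a')
  · refine hL _ _ _ _ fun h2 => h ?_
    by_cases h3 : x = a
    · obtain rfl := h3
      obtain rfl : x' = a' := h1.mp rfl
      simp
    · have h4 : ¬ x' = a' := fun h5 => h3 (h1.mpr h5)
      simpa [lexProduct, h3, h4] using h2
  · exact hF _ _ _ _ h1

/-- Summing over `x` forgets which fibre receives the fibre over `a` and keeps the motion inside it.
These entries play the role of `u⁽ᵃ⁾` in the wreath product. -/
theorem isMagicUnitary_fibre {p : V → V → B} (hu : IsMagicUnitary u) (hp : IsMagicUnitary p)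
    (hcol : ∀ x x' y', ∑ y, u (x, y) (x', y') = p x x') (a : V) :
    IsMagicUnitary fun y y' => ∑ x, u (a, y) (x, y') where
  isStarProjection i j := IsStarProjection.sum _ (fun _ _ => hu.isStarProjection _ _)
      fun a _ b _ h => hu.row_mul fun h' => h (congrArg Prod.fst h')
  row_sum y := by
    rw [sum_comm, ← Fintype.sum_prod_type, hu.row_sum]
  col_sum y' := by
    rw [sum_comm]
    simp_rw [hcol, hp.row_sum]

omit [Fintype W] in
theorem preserves_fibre (hL : Preserves u (lexProduct X Y).Adj)
    (hF : Preserves u fun p q => p.1 = q.1) (a : V) :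
    Preserves (fun y y' => ∑ x, u (a, y) (x, y')) Y.Adj := by
  intro y y' b b' h
  rw [sum_mul_sum]
  refine sum_eq_zero fun x _ => sum_eq_zero fun x' _ => ?_
  by_cases h1 : x = x'
  · subst h1
    refine hL _ _ _ _ fun h2 => h ?_
    simpa [lexProduct] using h2
  · exact hF _ _ _ _ fun h2 => h1 (h2.mp rfl)

/-- Each entry of the product's magic unitary is absorbed by its block sum, which is the image of an
entry for `X`. A vanishing entry for `X` would thus annihilate an entry for `X[Y]`. -/
theorem isQuantumVertexTransitive_of_lexProduct [Nonempty W]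
    (hF : Preserves (Qut (lexProduct X Y)).u fun p q => p.1 = q.1)
    (h : IsQuantumVertexTransitive (lexProduct X Y)) : IsQuantumVertexTransitive X := by
  have hu := (Qut (lexProduct X Y)).isMagicUnitary
  obtain ⟨p, hp, hrow, -⟩ := exists_block hu hF
  obtain ⟨f, hf⟩ := exists_qut_hom hp (preserves_block (qut_preserves _) hF hrow)
  intro x x' h0
  obtain ⟨w⟩ := ‹Nonempty W›
  apply h (x, w) (x', w)
  have h1 : p x x' = 0 := by rw [← hf, h0, map_zero]
  calc (Qut (lexProduct X Y)).u (x, w) (x', w)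
      = (Qut (lexProduct X Y)).u (x, w) (x', w) *
          ∑ y', (Qut (lexProduct X Y)).u (x, w) (x', y') := by
        rw [mul_sum, Fintype.sum_eq_single w fun y h =>
          hu.row_mul fun h' => h (congrArg Prod.snd h').symm, hu.mul_self]
    _ = 0 := by rw [hrow, h1, mul_zero]

theorem freeWreath_preserves [Nonempty W] :
    Preserves ((Qut Y).freeWreath (Qut X)).u (lexProduct X Y).Adj := by
  rintro ⟨x, y⟩ ⟨x', y'⟩ ⟨a, b⟩ ⟨a', b'⟩ h
  have hX := (Qut X).isMagicUnitary
  change (wreathInl (Qut Y) (Qut X) x ((Qut Y).u y y') *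
    wreathInr (Qut Y) (Qut X) ((Qut X).u x x')) * (wreathInl (Qut Y) (Qut X) a ((Qut Y).u b b') *
    wreathInr (Qut Y) (Qut X) ((Qut X).u a a')) = 0
  -- Commuting the second factor `u⁽ᵃ⁾` to the right brings the two entries of `Qut X` together.
  have hcomm : ∀ c c', wreathInr (Qut Y) (Qut X) ((Qut X).u x x') *
      wreathInr (Qut Y) (Qut X) ((Qut X).u a a') = 0 →
      (wreathInl (Qut Y) (Qut X) x ((Qut Y).u y y') *
    wreathInr (Qut Y) (Qut X) ((Qut X).u x x')) * (wreathInl (Qut Y) (Qut X) a ((Qut Y).u c c') *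
    wreathInr (Qut Y) (Qut X) ((Qut X).u a a')) = 0 := fun c c' h0 => by
    rw [(wreath_commute (Qut Y) (Qut X) c c' a a').eq, mul_assoc,
      ← mul_assoc (wreathInr (Qut Y) (Qut X) ((Qut X).u x x')), h0, zero_mul, mul_zero]
  by_cases h1 : X.Adj x a = X.Adj x' a'
  · by_cases h2 : (x = a) = (x' = a')
    · by_cases h3 : x = a
      · obtain rfl := h3
        obtain rfl : x' = a' := h2.mp rfl
        have h4 : Y.Adj y b ≠ Y.Adj y' b' := fun h5 => h (by simp [lexProduct, h5])
        rw [(wreath_commute (Qut Y) (Qut X) y y' x x').eq, mul_assoc,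
          ← mul_assoc (wreathInl (Qut Y) (Qut X) x _), ← map_mul,
          qut_preserves Y _ _ _ _ h4, map_zero, zero_mul, mul_zero]
      · have h4 : ¬ x' = a' := fun h5 => h3 (h2.mpr h5)
        exact absurd (by simp [lexProduct, h3, h4, h1]) h
    · exact hcomm b b' (by rw [← map_mul, Preserves.eq hX _ _ _ _ h2, map_zero])
  · exact hcomm b b' (by rw [← map_mul, qut_preserves X _ _ _ _ h1, map_zero])

/-- If the fibres of `X[Y]` over `X` are invariant under `Qut(X[Y])`, then `Qut(X[Y])` is the free
wreath product of `Qut(Y)` by `Qut(X)`. -/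
theorem qut_lexProduct_equal_freeWreath [Nonempty W]
    (hF : Preserves (Qut (lexProduct X Y)).u fun p q => p.1 = q.1) :
    (Qut (lexProduct X Y)).Equal ((Qut Y).freeWreath (Qut X)) := by
  have hu := (Qut (lexProduct X Y)).isMagicUnitary
  have hL := qut_preserves (lexProduct X Y)
  obtain ⟨f, hf⟩ := exists_qut_hom ((Qut Y).freeWreath (Qut X)).isMagicUnitary
    (freeWreath_preserves (X := X) (Y := Y))
  obtain ⟨p, hp, hrow, hcol⟩ := exists_block hu hF
  obtain ⟨g, hg⟩ := exists_qut_hom hp (preserves_block hL hF hrow)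
  choose k hk using fun a => exists_qut_hom (isMagicUnitary_fibre hu hp hcol a)
    (preserves_fibre hL hF a)
  -- Expanding `p a b` along the row `(a, i)`, orthogonality within that row leaves a single term.
  -- The reversed product gives the same entry, hence the commutation needed for the wreath product.
  have h1 : ∀ i j a b, (∑ x, (Qut (lexProduct X Y)).u (a, i) (x, j)) * p a b =
      (Qut (lexProduct X Y)).u (a, i) (b, j) := fun i j a b => by
    rw [← hrow a b i, sum_mul, Fintype.sum_eq_single b, mul_sum, Fintype.sum_eq_single j,
      hu.mul_self]
    · exact fun j' h => hu.row_mul fun h' => h (congrArg Prod.snd h').symm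
    · intro x h
      rw [mul_sum]
      exact sum_eq_zero fun y _ => hu.row_mul fun h' => h (congrArg Prod.fst h')
  have h2 : ∀ i j a b, p a b * (∑ x, (Qut (lexProduct X Y)).u (a, i) (x, j)) =
      (Qut (lexProduct X Y)).u (a, i) (b, j) := fun i j a b => by
    rw [← hrow a b i, mul_sum, Fintype.sum_eq_single b, sum_mul, Fintype.sum_eq_single j,
      hu.mul_self]
    · exact fun j' h => hu.row_mul fun h' => h (congrArg Prod.snd h')
    · intro x h
      rw [sum_mul]
      exact sum_eq_zero fun y _ => hu.row_mul fun h' => h (congrArg Prod.fst h').symm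
  obtain ⟨F, hFF⟩ := exists_wreath_hom (Qut Y) (Qut X) k g fun i j a b => by
    rw [hk, hg, commute_iff_eq, h1, h2]
  refine QuantumPermGroup.equalVia_of_homs f F hf fun q r => ?_
  rw [hFF]
  simp only [hk, hg]
  exact h1 _ _ _ _

end Blocks

/-! ### Twins, and recognising fibres by counting common neighbours -/

section Twins

variable {V W : Type}

/-- Two vertices are twins if they have the same neighbours. -/
def AreTwins (X : SimpleGraph V) (x x' : V) : Prop := ∀ z, X.Adj x z ↔ X.Adj x' z

/-- No two distinct vertices have the same neighbours. -/
def TwinFree (X : SimpleGraph V) : Prop := ∀ x x', AreTwins X x x' → x = x'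

/-- All vertices have `k` neighbours. -/
def HasDegree (X : SimpleGraph V) (k : ℕ) : Prop := ∀ x, {z | X.Adj x z}.ncard = k

/-- The common neighbours lie in two neighbourhoods of size `k`, so `k` of them fill both. This
makes twinship a counting relation, hence an invariant one. -/
theorem HasDegree.areTwins_iff [Finite V] {X : SimpleGraph V} {k : ℕ} (hk : HasDegree X k)
    (x x' : V) : AreTwins X x x' ↔ k ≤ {z | X.Adj x z ∧ X.Adj z x'}.ncard := by
  have h1 : {z | X.Adj x z ∧ X.Adj z x'} ⊆ {z | X.Adj x z} := fun z h => h.1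
  have h2 : {z | X.Adj x z ∧ X.Adj z x'} ⊆ {z | X.Adj x' z} := fun z h => h.2.symm
  constructor
  · intro h
    rw [← hk x]
    exact Set.ncard_le_ncard fun z hz => ⟨hz, ((h z).1 hz).symm⟩
  · intro h z
    have h3 := Set.eq_of_subset_of_ncard_le h1 ((hk x).le.trans h)
    have h4 := Set.eq_of_subset_of_ncard_le h2 ((hk x').le.trans h)
    exact Set.ext_iff.1 (h3.symm.trans h4) z

theorem lexProduct_compl (X : SimpleGraph V) (Y : SimpleGraph W) :
    (lexProduct X Y)ᶜ = lexProduct Xᶜ Yᶜ := by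
  ext ⟨x, y⟩ ⟨x', y'⟩
  by_cases h : x = x'
  · subst h
    simp [lexProduct, SimpleGraph.compl_adj]
  · simp [lexProduct, SimpleGraph.compl_adj, h]

variable [Fintype V] [Fintype W]

/-- In `X[Y]` with `X` regular and twin-free, two non-adjacent points lie in the same fibre over
`X` if and only if they have many common neighbours. -/
theorem lexProduct_fibre_iff [Nonempty W] {X : SimpleGraph V} (Y : SimpleGraph W) {k : ℕ}
    (hk : HasDegree X k) (hX : TwinFree X) (p q : V × W) :
    (p.1 = q.1 ∧ ¬ Y.Adj p.2 q.2) ↔ ¬ (lexProduct X Y).Adj p q ∧ k * Nat.card W ≤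
      {m | (lexProduct X Y).Adj p m ∧ (lexProduct X Y).Adj m q}.ncard := by
  obtain ⟨x, y⟩ := p
  obtain ⟨x', y'⟩ := q
  simp only
  constructor
  · rintro ⟨rfl, h⟩
    refine ⟨by simp [lexProduct, h], ?_⟩
    rw [← hk x, ← Set.ncard_univ W, ← Set.ncard_prod]
    exact Set.ncard_le_ncard fun m hm => ⟨Or.inl hm.1, Or.inl (SimpleGraph.Adj.symm hm.1)⟩
  · rintro ⟨h1, h2⟩
    by_cases hx : x = x'
    · exact ⟨hx, fun h => h1 (Or.inr ⟨hx, h⟩)⟩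
    · have h3 : ¬ X.Adj x x' := fun h => h1 (Or.inl h)
      -- A common neighbour inside one of the two fibres would make `x` and `x'` adjacent. So all of
      -- them lie over common neighbours of `x` and `x'`, and there are too few unless these are
      -- twins.
      have h4 : {m | (lexProduct X Y).Adj (x, y) m ∧ (lexProduct X Y).Adj m (x', y')} ⊆
          {z | X.Adj x z ∧ X.Adj z x'} ×ˢ Set.univ := by
        rintro ⟨z, w⟩ ⟨h5 | ⟨h5, -⟩, h6 | ⟨h6, -⟩⟩
        · exact ⟨⟨h5, h6⟩, trivial⟩
        · exact absurd ((show z = x' from h6) ▸ h5) h3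
        · exact absurd ((show x = z from h5) ▸ h6) h3
        · exact absurd ((show x = z from h5).trans h6) hx
      have h5 := h2.trans (Set.ncard_le_ncard h4)
      rw [Set.ncard_prod, Set.ncard_univ] at h5
      exact absurd (hX x x' ((hk.areTwins_iff x x').2
        (Nat.le_of_mul_le_mul_right h5 Nat.card_pos))) hx

variable {B : Type} [CStarAlgebra B]

theorem preserves_fibre_nonadj [Nonempty W] {X : SimpleGraph V} {Y : SimpleGraph W} {k : ℕ}
    {u : V × W → V × W → B} (hu : IsMagicUnitary u) (hL : Preserves u (lexProduct X Y).Adj)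
    (hk : HasDegree X k) (hX : TwinFree X) :
    Preserves u fun p q => p.1 = q.1 ∧ ¬ Y.Adj p.2 q.2 := by
  have h := hL.map₂ (Preserves.ncard hu hL hL) fun P n => ¬ P ∧ k * Nat.card W ≤ n
  simpa only [← lexProduct_fibre_iff Y hk hX] using h

/-- Non-adjacency inside a fibre is invariant, and a connected `Yᶜ` makes its transitive closure the
whole fibre. -/
theorem preserves_fst_of_compl_preconnected [Nonempty W] {X : SimpleGraph V} {Y : SimpleGraph W}
    {k : ℕ} {u : V × W → V × W → B} (hu : IsMagicUnitary u)
    (hL : Preserves u (lexProduct X Y).Adj) (hk : HasDegree X k) (hX : TwinFree X)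
    (hY : Yᶜ.Preconnected) : Preserves u fun p q => p.1 = q.1 := by
  have h := (preserves_fibre_nonadj hu hL hk hX).reflTransGen hu
  have h1 : Relation.ReflTransGen (fun p q : V × W => p.1 = q.1 ∧ ¬ Y.Adj p.2 q.2) =
      fun p q => p.1 = q.1 := by
    ext ⟨x, y⟩ ⟨x', y'⟩
    constructor
    · generalize (x', y') = q
      intro h
      induction h with
      | refl => rfl
      | tail _ h ih => exact ih.trans h.1
    · rintro rfl
      have h1 := (SimpleGraph.reachable_iff_reflTransGen y y').1 (hY y y')
      induction h1 with
      | refl => exact .refl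
      | tail _ h ih => exact ih.tail ⟨rfl, h.2⟩
  rwa [h1] at h

/-- The graph detects non-adjacent pairs in a fibre, its complement detects adjacent ones; the union
is the fibre relation, with no condition on `Y`. -/
theorem preserves_fst_of_twinFree [Nonempty W] {X : SimpleGraph V} {Y : SimpleGraph W}
    {k l : ℕ} {u : V × W → V × W → B} (hu : IsMagicUnitary u)
    (hL : Preserves u (lexProduct X Y).Adj) (hk : HasDegree X k) (hX : TwinFree X)
    (hl : HasDegree Xᶜ l) (hX' : TwinFree Xᶜ) : Preserves u fun p q => p.1 = q.1 := by
  have h1 := preserves_fibre_nonadj hu hL hk hX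
  have h2 := preserves_fibre_nonadj hu (lexProduct_compl X Y ▸ hL.compl hu) hl hX'
  refine cast (congrArg (Preserves u) ?_) (h1.map₂ h2 fun P Q => P ∨ Q)
  ext p q
  simp only [SimpleGraph.compl_adj]
  tauto

theorem preserves_fst_of_preconnected [Nonempty W] {X : SimpleGraph V} {Y : SimpleGraph W}
    {l : ℕ} {u : V × W → V × W → B} (hu : IsMagicUnitary u)
    (hL : Preserves u (lexProduct X Y).Adj) (hl : HasDegree Xᶜ l) (hX' : TwinFree Xᶜ)
    (hY : Y.Preconnected) : Preserves u fun p q => p.1 = q.1 :=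
  preserves_fst_of_compl_preconnected hu (lexProduct_compl X Y ▸ hL.compl hu) hl hX'
    (by rwa [compl_compl])

end Twins

/-! ### Regularity and twins in quantum vertex-transitive graphs -/

section QuantumVertexTransitive

variable {V W : Type} [Fintype V] [Fintype W] {X : SimpleGraph V}

theorem IsQuantumVertexTransitive.ncard_eq (hX : IsQuantumVertexTransitive X) {R : V → V → Prop}
    (hR : Preserves (Qut X).u R) (x x' : V) : {z | R x z}.ncard = {z | R x' z}.ncard :=
  Preserves.ncard_right (Qut X).isMagicUnitary hR (hX x x')

theorem IsQuantumVertexTransitive.exists_hasDegree (hX : IsQuantumVertexTransitive X) :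
    ∃ k, HasDegree X k := by
  rcases isEmpty_or_nonempty V with h | ⟨⟨x⟩⟩
  · exact ⟨0, fun x => h.elim x⟩
  · exact ⟨_, fun y => hX.ncard_eq (qut_preserves X) y x⟩

theorem IsQuantumVertexTransitive.preserves_areTwins (hX : IsQuantumVertexTransitive X) :
    Preserves (Qut X).u (AreTwins X) := by
  obtain ⟨k, hk⟩ := hX.exists_hasDegree
  have hu := (Qut X).isMagicUnitary
  have h := (Preserves.ncard hu (qut_preserves X) (qut_preserves X)).map fun n => k ≤ n
  simpa only [← hk.areTwins_iff] using h

theorem IsQuantumVertexTransitive.of_equalVia {Y : SimpleGraph W} {e : V ≃ W}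
    (h : (Qut X).EqualVia e (Qut Y)) (hX : IsQuantumVertexTransitive X) :
    IsQuantumVertexTransitive Y := by
  obtain ⟨Φ, hΦ⟩ := h
  intro y y' h
  refine hX (e.symm y) (e.symm y') (EquivLike.injective Φ ?_)
  rw [hΦ, e.apply_symm_apply, e.apply_symm_apply, h, map_zero]

theorem IsQuantumVertexTransitive.compl (hX : IsQuantumVertexTransitive X) :
    IsQuantumVertexTransitive Xᶜ := hX.of_equalVia (qut_equal_compl X)

/-- Twin classes all have one size, so if `X` and `Xᶜ` both had twins, some `y` would have a twin
`y''` in `X` and a twin `y'` in `Xᶜ`. Then `y` is adjacent to `y'`, hence so is `y''`; as `y` and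
`y'` are twins in `Xᶜ`, `y` is adjacent to `y''`. But twins are never adjacent. -/
theorem IsQuantumVertexTransitive.twinFree_or (hX : IsQuantumVertexTransitive X) :
    TwinFree X ∨ TwinFree Xᶜ := by
  refine or_iff_not_imp_left.2 fun h => ?_
  simp only [TwinFree, not_forall] at h
  obtain ⟨x, x', h, hne⟩ := h
  intro y y' hy
  by_contra hyy
  have h1 : 1 < {z | AreTwins X y z}.ncard := by
    rw [hX.ncard_eq hX.preserves_areTwins y x, Set.one_lt_ncard]
    exact ⟨x, fun _ => Iff.rfl, x', h, hne⟩
  obtain ⟨y'', h2, h3⟩ := Set.exists_ne_of_one_lt_ncard h1 y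
  have h2 : AreTwins X y y'' := h2
  have h4 : X.Adj y y' := by
    by_contra h5
    exact Xᶜ.irrefl ((hy y').1 ⟨hyy, h5⟩)
  have h6 : ¬ Xᶜ.Adj y y'' := fun h7 => ((hy y'').1 h7).2 (((h2 y').1 h4).symm)
  have h7 : X.Adj y y'' := by
    by_contra h8
    exact h6 ⟨h3.symm, h8⟩
  exact X.irrefl ((h2 y'').1 h7)

end QuantumVertexTransitive

/-! ### The twin quotient and the maximal outer factor -/

section TwinQuotient

variable {V V' U : Type}

/-- Being twins, as an equivalence relation. -/
def twinSetoid (X : SimpleGraph V) : Setoid V where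
  r := AreTwins X
  iseqv := ⟨fun _ _ => Iff.rfl, fun h z => (h z).symm, fun h h' z => (h z).trans (h' z)⟩

/-- The graph on the twin classes of `X`. -/
def twinQuotient (X : SimpleGraph V) : SimpleGraph (Quotient (twinSetoid X)) where
  Adj a b := X.Adj a.out b.out
  symm := ⟨fun _ _ h => h.symm⟩
  loopless := ⟨fun _ h => X.irrefl h⟩

theorem twinQuotient_adj (X : SimpleGraph V) (v w : V) :
    (twinQuotient X).Adj (Quotient.mk _ v) (Quotient.mk _ w) ↔ X.Adj v w := by
  have h : ∀ v, AreTwins X (Quotient.mk (twinSetoid X) v).out v := fun v =>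
    Quotient.mk_out (s := twinSetoid X) v
  exact ((h v _).trans (X.adj_comm _ _)).trans ((h w v).trans (X.adj_comm _ _))

theorem twinFree_twinQuotient (X : SimpleGraph V) : TwinFree (twinQuotient X) := by
  intro a b h
  induction a using Quotient.inductionOn with | _ v
  induction b using Quotient.inductionOn with | _ w
  refine Quotient.sound fun z => ?_
  rw [← twinQuotient_adj, h, twinQuotient_adj]

theorem areTwins_lexProduct_bot [Nonempty U] (X : SimpleGraph V) (p q : V × U) :
    AreTwins (lexProduct X (⊥ : SimpleGraph U)) p q ↔ AreTwins X p.1 q.1 := by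
  obtain ⟨w⟩ := ‹Nonempty U›
  simp only [AreTwins, lexProduct, SimpleGraph.bot_adj, and_false, or_false]
  exact ⟨fun h z => h (z, w), fun h z => h z.1⟩

theorem areTwins_iso {X : SimpleGraph V} {X' : SimpleGraph V'} (φ : X ≃g X') (x x' : V) :
    AreTwins X' (φ x) (φ x') ↔ AreTwins X x x' := by
  refine ⟨fun h z => ?_, fun h z => ?_⟩
  · rw [← φ.map_adj_iff, h, φ.map_adj_iff]
  · obtain ⟨z, rfl⟩ := φ.surjective z
    rw [φ.map_adj_iff, h, φ.map_adj_iff]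

/-- A twin class of `X'[K̄ₐ]` is a twin class of `X'` times `Fin a`. So `a` never exceeds the class
size of `X`, and equals it only if the class in `X'` is a singleton. -/
theorem ncard_areTwins {a : ℕ} [NeZero a] {X : SimpleGraph V} {X' : SimpleGraph V'}
    (φ : X ≃g lexProduct X' (⊥ : SimpleGraph (Fin a))) (x : V) :
    {z | AreTwins X x z}.ncard = {z | AreTwins X' (φ x).1 z}.ncard * a := by
  have h : {z | AreTwins X x z} =
      φ ⁻¹' ({z | AreTwins X' (φ x).1 z} ×ˢ (Set.univ : Set (Fin a))) := by
    ext z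
    exact (areTwins_iso φ x z).symm.trans
      ((areTwins_lexProduct_bot X' _ _).trans (and_true _).to_iff.symm)
  rw [h, Set.ncard_preimage_of_injective_subset_range φ.injective
    (φ.surjective.range_eq ▸ Set.subset_univ _), Set.ncard_prod, Set.ncard_univ, Nat.card_fin]

theorem exists_iso_twinQuotient {X : SimpleGraph V} [Finite V] {m : ℕ}
    (hm : ∀ x, {z | AreTwins X x z}.ncard = m) :
    Nonempty (X ≃g lexProduct (twinQuotient X) (⊥ : SimpleGraph (Fin m))) := by
  have h1 : ∀ c : Quotient (twinSetoid X), Nat.card {v // Quotient.mk (twinSetoid X) v = c} = m := by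
    intro c
    induction c using Quotient.inductionOn with | _ v
    rw [← hm v]
    refine congrArg Set.ncard (Set.ext fun w => ?_)
    exact ⟨fun h => Quotient.exact h.symm, fun h => (Quotient.sound h).symm⟩
  let e : V ≃ Quotient (twinSetoid X) × Fin m :=
    (Equiv.sigmaFiberEquiv (Quotient.mk (twinSetoid X))).symm.trans
      ((Equiv.sigmaCongrRight fun c => Finite.equivFinOfCardEq (h1 c)).trans
        (Equiv.sigmaEquivProd _ _))
  refine ⟨⟨e, fun {v w} => ?_⟩⟩
  simp only [lexProduct, SimpleGraph.bot_adj, and_false, or_false]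
  exact twinQuotient_adj X v w

variable [Fintype V] [Fintype V']

/-- The twin quotient is twin-free, so the fibres over it are precisely the twin classes. These are
invariant, and quantum vertex transitivity descends. -/
theorem IsQuantumVertexTransitive.hasOuterFactor {X : SimpleGraph V}
    (hX : IsQuantumVertexTransitive X) {m : ℕ} [NeZero m]
    (hm : ∀ x, {z | AreTwins X x z}.ncard = m) :
    HasOuterFactor X (⊥ : SimpleGraph (Fin m)) := by
  obtain ⟨φ⟩ := exists_iso_twinQuotient hm
  let _ : Fintype (Quotient (twinSetoid X)) := Fintype.ofFinite _
  have h1 := hX.of_equalVia (qut_equalVia_of_iso φ)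
  refine ⟨_, inferInstance, twinQuotient X, isQuantumVertexTransitive_of_lexProduct ?_ h1, ⟨φ⟩⟩
  refine cast (congrArg (Preserves _) ?_) h1.preserves_areTwins
  ext p q
  rw [areTwins_lexProduct_bot]
  exact ⟨fun h => twinFree_twinQuotient X _ _ h, fun h => h ▸ fun _ => Iff.rfl⟩

theorem one_le_ncard_areTwins {X : SimpleGraph V} (x : V) : 1 ≤ {z | AreTwins X x z}.ncard :=
  Nat.one_le_iff_ne_zero.2 (Set.ncard_ne_zero_of_mem (a := x) fun _ => Iff.rfl)

/-- The size of the twin classes of a quantum vertex-transitive graph `X` is the largest `a` with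
`X = X'[K̄ₐ]`. -/
theorem IsQuantumVertexTransitive.isGreatest_outer {X : SimpleGraph V}
    (hX : IsQuantumVertexTransitive X) (x : V) {m : ℕ+}
    (hm : {z | AreTwins X x z}.ncard = m) :
    IsGreatest {a : ℕ+ | HasOuterFactor X (⊥ : SimpleGraph (Fin a))} m := by
  constructor
  · have : NeZero (m : ℕ) := ⟨m.ne_zero⟩
    exact hX.hasOuterFactor fun y => (hX.ncard_eq hX.preserves_areTwins y x).trans hm
  · rintro a ⟨V'', _, X'', -, ⟨φ⟩⟩
    have : NeZero (a : ℕ) := ⟨a.ne_zero⟩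
    rw [ncard_areTwins φ] at hm
    refine PNat.coe_le_coe _ _ |>.1 (hm ▸ ?_)
    exact Nat.le_mul_of_pos_left _ (one_le_ncard_areTwins _)

theorem IsQuantumVertexTransitive.exists_isGreatest_outer {X : SimpleGraph V}
    (hX : IsQuantumVertexTransitive X) (h : ¬ TwinFree X) :
    ∃ α : ℕ+, 1 < α ∧ IsGreatest {a : ℕ+ | HasOuterFactor X (⊥ : SimpleGraph (Fin a))} α := by
  simp only [TwinFree, not_forall] at h
  obtain ⟨x, x', h, hne⟩ := h
  refine ⟨⟨{z | AreTwins X x z}.ncard, one_le_ncard_areTwins x⟩, ?_,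
    hX.isGreatest_outer x rfl⟩
  refine PNat.coe_lt_coe _ _ |>.1 ((Set.one_lt_ncard).2 ?_)
  exact ⟨x, fun _ => Iff.rfl, x', h, hne⟩

theorem IsQuantumVertexTransitive.twinFree_of_isGreatest {X : SimpleGraph V}
    (hX : IsQuantumVertexTransitive X) {X' : SimpleGraph V'} {α : ℕ+}
    (hα : IsGreatest {a : ℕ+ | HasOuterFactor X (⊥ : SimpleGraph (Fin a))} α)
    (φ : X ≃g lexProduct X' (⊥ : SimpleGraph (Fin α))) : TwinFree X' := by
  intro x x' h
  by_contra hne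
  have : NeZero (α : ℕ) := ⟨α.ne_zero⟩
  obtain ⟨v, hv⟩ := φ.surjective (x, 0)
  have h1 := (hX.isGreatest_outer v
    (m := ⟨{z | AreTwins X v z}.ncard, one_le_ncard_areTwins v⟩) rfl).unique hα
  have h2 := (ncard_areTwins φ v).symm.trans (congrArg PNat.val h1)
  rw [hv] at h2
  have h3 : 1 < {z | AreTwins X' x z}.ncard :=
    (Set.one_lt_ncard).2 ⟨x, fun _ => Iff.rfl, x', h, hne⟩
  have h4 := α.pos
  have h5 : {z | AreTwins X' x z}.ncard * (α : ℕ) = α := h2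
  nlinarith

end TwinQuotient

/-! ### Connected components and the maximal inner factor -/

section Components

open SimpleGraph

variable {W W' : Type}

/-- For each component choose an automorphism taking `w₀` to a representative. It carries the
component of `w₀` onto that component, so `Y` is a disjoint union of copies of one graph. -/
theorem IsVertexTransitive.exists_component {Y : SimpleGraph W} [Finite W]
    (hY : IsVertexTransitive Y) (w₀ : W) {c : ℕ} (hc : Nat.card Y.ConnectedComponent = c) :
    HasInnerFactor Y (⊥ : SimpleGraph (Fin c)) := by
  choose φ hφ using fun C : Y.ConnectedComponent => hY w₀ C.out
  have hreach : ∀ (C : Y.ConnectedComponent) (w : W), Y.Reachable w₀ w →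
      Y.connectedComponentMk (φ C w) = C := fun C w hw => by
    have h1 : Y.Reachable C.out (φ C w) := hφ C ▸ (φ C).reachable_iff.2 hw
    exact (ConnectedComponent.eq.2 h1).symm.trans (Quot.out_eq C)
  let g : Y.ConnectedComponent × {w // Y.Reachable w₀ w} → W := fun p => φ p.1 p.2
  have hg : g.Bijective := by
    constructor
    · rintro ⟨C, w, hw⟩ ⟨D, v, hv⟩ h
      obtain rfl : C = D := (hreach C w hw).symm.trans
        ((congrArg Y.connectedComponentMk h).trans (hreach D v hv))
      obtain rfl : w = v := (φ C).injective h
      rfl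
    · intro v
      let C := Y.connectedComponentMk v
      refine ⟨⟨C, (φ C).symm v, ?_⟩, (φ C).apply_symm_apply v⟩
      rw [← (φ C).reachable_iff, hφ, RelIso.apply_symm_apply]
      exact ConnectedComponent.eq.1 (Quot.out_eq C)
  have hadj : ∀ p q, Y.Adj (g p) (g q) ↔
      p.1 = q.1 ∧ (Y.induce {w | Y.Reachable w₀ w}).Adj p.2 q.2 := by
    rintro ⟨C, w, hw⟩ ⟨D, v, hv⟩
    have h1 : Y.Adj (g (C, ⟨w, hw⟩)) (g (D, ⟨v, hv⟩)) → C = D := fun h =>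
      (hreach C w hw).symm.trans ((ConnectedComponent.eq.2 h.reachable).trans (hreach D v hv))
    constructor
    · intro h
      obtain rfl := h1 h
      exact ⟨rfl, (φ C).map_adj_iff.1 h⟩
    · rintro ⟨h, h'⟩
      obtain rfl : C = D := h
      exact (φ C).map_adj_iff.2 h'
  let e := Finite.equivFinOfCardEq hc
  refine ⟨_, inferInstance, Y.induce {w | Y.Reachable w₀ w}, ?_, ⟨RelIso.symm
    ⟨(e.symm.prodCongr (Equiv.refl _)).trans (Equiv.ofBijective g hg), fun {p q} => ?_⟩⟩⟩
  -- An automorphism of `Y` moving `a` to `b` within one component maps that component to itself.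
  · rintro ⟨a, ha⟩ ⟨b, hb⟩
    obtain ⟨ψ, rfl⟩ := hY a b
    refine ⟨⟨ψ.toEquiv.subtypeEquiv fun w => ?_, fun {p q} => ψ.map_adj_iff⟩, rfl⟩
    have h1 : Y.Reachable a w ↔ Y.Reachable (ψ a) (ψ w) := ψ.reachable_iff.symm
    exact ⟨fun h => hb.trans (h1.1 (ha.symm.trans h)), fun h => ha.trans (h1.2 (hb.symm.trans h))⟩
  · refine (hadj _ _).trans ?_
    simp only [lexProduct, bot_adj, false_or]
    exact and_congr_left fun _ => e.symm.injective.eq_iff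

/-- Copy index and component in `Y'` are constant along edges of `Y`, so they define a surjection
from its components. -/
theorem card_mul_le_card_connectedComponent {Y : SimpleGraph W} {Y' : SimpleGraph W'} [Finite W]
    {b : ℕ} (ψ : Y ≃g lexProduct (⊥ : SimpleGraph (Fin b)) Y') :
    b * Nat.card Y'.ConnectedComponent ≤ Nat.card Y.ConnectedComponent := by
  have h : ∀ v w, Y.Adj v w → ((ψ v).1, Y'.connectedComponentMk (ψ v).2) =
      ((ψ w).1, Y'.connectedComponentMk (ψ w).2) := by
    intro v w h
    rcases ψ.map_adj_iff.2 h with h | ⟨h1, h2⟩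
    · exact h.elim
    · exact Prod.ext h1 (ConnectedComponent.eq.2 h2.reachable)
  let f : Y.ConnectedComponent → Fin b × Y'.ConnectedComponent :=
    Quot.lift (fun w => ((ψ w).1, Y'.connectedComponentMk (ψ w).2)) fun v w hvw => by
      rw [reachable_iff_reflTransGen] at hvw
      induction hvw with
      | refl => rfl
      | tail _ hvw ih => exact ih.trans (h _ _ hvw)
  have hf : f.Surjective := by
    rintro ⟨i, C⟩
    induction C using ConnectedComponent.ind with | _ w
    obtain ⟨v, hv⟩ := ψ.surjective (i, w)
    refine ⟨Y.connectedComponentMk v, ?_⟩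
    change ((ψ v).1, Y'.connectedComponentMk (ψ v).2) = _
    rw [hv]
  have := Nat.card_le_card_of_surjective f hf
  rwa [Nat.card_prod, Nat.card_fin] at this

/-- The number of components of a vertex-transitive graph `Y` is the largest `b` with
`Y = K̄_b[Y']`. -/
theorem IsVertexTransitive.isGreatest_inner {Y : SimpleGraph W} [Finite W] [Nonempty W]
    (hY : IsVertexTransitive Y) {c : ℕ+} (hc : Nat.card Y.ConnectedComponent = c) :
    IsGreatest {b : ℕ+ | HasInnerFactor Y (⊥ : SimpleGraph (Fin b))} c := by
  obtain ⟨w₀⟩ := ‹Nonempty W›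
  refine ⟨hY.exists_component w₀ hc, ?_⟩
  rintro b ⟨W', _, Y', -, ⟨ψ⟩⟩
  have h := card_mul_le_card_connectedComponent ψ
  have : Nonempty Y'.ConnectedComponent := ⟨Y'.connectedComponentMk (ψ w₀).2⟩
  exact PNat.coe_le_coe _ _ |>.1
    ((Nat.le_mul_of_pos_right _ Nat.card_pos).trans (h.trans hc.le))

theorem one_lt_card_connectedComponent {Y : SimpleGraph W} [Finite W] (h : ¬ Y.Preconnected) :
    1 < Nat.card Y.ConnectedComponent := by
  simp only [Preconnected, not_forall] at h
  obtain ⟨a, b, h⟩ := h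
  have : Nontrivial Y.ConnectedComponent :=
    ⟨Y.connectedComponentMk a, Y.connectedComponentMk b, fun h' => h (ConnectedComponent.eq.1 h')⟩
  exact Finite.one_lt_card

theorem IsVertexTransitive.exists_isGreatest_inner {Y : SimpleGraph W} [Finite W] [Nonempty W]
    (hY : IsVertexTransitive Y) (h : ¬ Y.Preconnected) :
    ∃ β : ℕ+, 1 < β ∧ IsGreatest {b : ℕ+ | HasInnerFactor Y (⊥ : SimpleGraph (Fin b))} β :=
  ⟨⟨Nat.card Y.ConnectedComponent, Nat.card_pos⟩, one_lt_card_connectedComponent h,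
    hY.isGreatest_inner rfl⟩

/-- The greatest `β` is the number of components of `Y`, which is at least `β` times that of `Y'`;
two components in `Y'` would be too many. -/
theorem IsVertexTransitive.preconnected_of_isGreatest {Y : SimpleGraph W} [Finite W] [Finite W']
    [Nonempty W'] (hY : IsVertexTransitive Y) {Y' : SimpleGraph W'} {β : ℕ+}
    (hβ : IsGreatest {b : ℕ+ | HasInnerFactor Y (⊥ : SimpleGraph (Fin b))} β)
    (ψ : Y ≃g lexProduct (⊥ : SimpleGraph (Fin β)) Y') : Y'.Preconnected := by
  by_contra h
  have : NeZero (β : ℕ) := ⟨β.ne_zero⟩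
  have : Nonempty W := ψ.toEquiv.nonempty
  have h1 := (hY.isGreatest_inner
    (c := ⟨Nat.card Y.ConnectedComponent, Nat.card_pos⟩) rfl).unique hβ
  have h2 : Nat.card Y.ConnectedComponent = β := congrArg PNat.val h1
  have h3 := card_mul_le_card_connectedComponent ψ
  have h4 := one_lt_card_connectedComponent h
  have h5 := β.pos
  rw [h2] at h3
  nlinarith

end Components

/-! ### Passing to complements -/

section Complements

variable {V W V' U : Type}

/-- An isomorphism of graphs as an isomorphism of their complements. -/
def complIso {X : SimpleGraph V} {Y : SimpleGraph W} (φ : X ≃g Y) : Xᶜ ≃g Yᶜ where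
  toEquiv := φ.toEquiv
  map_rel_iff' {a b} := by
    simp only [SimpleGraph.compl_adj]
    exact and_congr (φ.toEquiv.injective.ne_iff) (not_congr φ.map_adj_iff)

/-- An isomorphism onto a lexicographic product, for the complements. -/
def complLexIso {X : SimpleGraph V} {Y : SimpleGraph W} {Z : SimpleGraph U}
    (φ : X ≃g lexProduct Y Z) : Xᶜ ≃g lexProduct Yᶜ Zᶜ where
  toEquiv := φ.toEquiv
  map_rel_iff' := by
    rw [← lexProduct_compl]
    exact (complIso φ).map_adj_iff

theorem IsVertexTransitive.compl {X : SimpleGraph V} (h : IsVertexTransitive X) :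
    IsVertexTransitive Xᶜ := fun x x' =>
  (h x x').elim fun φ hφ => ⟨complIso φ, hφ⟩

theorem HasOuterFactor.compl {X : SimpleGraph V} {K : SimpleGraph U} (h : HasOuterFactor X K) :
    HasOuterFactor Xᶜ Kᶜ := by
  obtain ⟨V', _, X', h, ⟨φ⟩⟩ := h
  exact ⟨V', inferInstance, X'ᶜ, h.compl, ⟨complLexIso φ⟩⟩

theorem HasInnerFactor.compl {Y : SimpleGraph W} {K : SimpleGraph U} (h : HasInnerFactor Y K) :
    HasInnerFactor Yᶜ Kᶜ := by
  obtain ⟨W', _, Y', h, ⟨φ⟩⟩ := h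
  exact ⟨W', inferInstance, Y'ᶜ, h.compl, ⟨complLexIso φ⟩⟩

theorem hasOuterFactor_compl_bot {X : SimpleGraph V} :
    HasOuterFactor Xᶜ (⊥ : SimpleGraph U) ↔ HasOuterFactor X (⊤ : SimpleGraph U) :=
  ⟨fun h => by simpa using h.compl, fun h => by simpa using h.compl⟩

theorem hasInnerFactor_compl_bot {Y : SimpleGraph W} :
    HasInnerFactor Yᶜ (⊥ : SimpleGraph U) ↔ HasInnerFactor Y (⊤ : SimpleGraph U) :=
  ⟨fun h => by simpa using h.compl, fun h => by simpa using h.compl⟩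

end Complements

/-! ### Merging the middle factors and the main theorem -/

section Main

variable {V W V' W' : Type}

/-- `X'[K̄ₘ][K̄ₙ[Y']] ≅ X'[K̄ₘₙ[Y']]`. -/
def mergeIso {m n : ℕ} {X : SimpleGraph V} {Y : SimpleGraph W} {X' : SimpleGraph V'}
    {Y' : SimpleGraph W'} (φ : X ≃g lexProduct X' (⊥ : SimpleGraph (Fin m)))
    (ψ : Y ≃g lexProduct (⊥ : SimpleGraph (Fin n)) Y') :
    lexProduct X Y ≃g lexProduct X' (lexProduct (⊥ : SimpleGraph (Fin (m * n))) Y') where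
  toEquiv := mergeEquiv φ.toEquiv ψ.toEquiv
  map_rel_iff' {p q} := by
    obtain ⟨x, y⟩ := p
    obtain ⟨x', y'⟩ := q
    change X'.Adj (φ x).1 (φ x').1 ∨ (φ x).1 = (φ x').1 ∧ (False ∨
      finProdFinEquiv ((φ x).2, (ψ y).1) = finProdFinEquiv ((φ x').2, (ψ y').1) ∧
        Y'.Adj (ψ y).2 (ψ y').2) ↔ X.Adj x x' ∨ (x = x' ∧ Y.Adj y y')
    rw [← φ.map_adj_iff, ← ψ.map_adj_iff, ← φ.injective.eq_iff, finProdFinEquiv.injective.eq_iff,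
      Prod.ext_iff, Prod.ext_iff]
    simp only [lexProduct, SimpleGraph.bot_adj]
    tauto

/-- Distinct copies of `Y` are completely joined in the complement; two points of one copy are
linked through another, which exists because `1 < n`. -/
theorem compl_bot_lexProduct_preconnected {n : ℕ} (hn : 1 < n) (Y : SimpleGraph W) :
    (lexProduct (⊥ : SimpleGraph (Fin n)) Y)ᶜ.Preconnected := by
  have h1 : ∀ i j : Fin n, ∀ y z : W, i ≠ j →
      (lexProduct (⊥ : SimpleGraph (Fin n)) Y)ᶜ.Adj (i, y) (j, z) := fun i j y z h =>
    ⟨fun h' => h (congrArg Prod.fst h'), by simp [lexProduct, h]⟩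
  rintro ⟨i, y⟩ ⟨j, z⟩
  have : Nontrivial (Fin n) := Fin.nontrivial_iff_two_le.2 hn
  by_cases h : i = j
  · subst h
    obtain ⟨k, hk⟩ := exists_ne i
    exact (h1 i k y y hk.symm).reachable.trans (h1 k i y z hk).reachable
  · exact (h1 i j y z h).reachable

theorem qut_bot_equal (n : ℕ) :
    (Qut (⊥ : SimpleGraph (Fin n))).Equal (quantumSymmetricGroup n) := by
  have h : {r : FreeStarAlg (Fin n × Fin n) | ∃ i j k l,
      ¬((⊥ : SimpleGraph (Fin n)).Adj i k ↔ (⊥ : SimpleGraph (Fin n)).Adj j l) ∧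
        r = FreeStarAlg.gen (i, j) * FreeStarAlg.gen (k, l)} = ∅ := by
    ext r
    simp
  rw [quantumSymmetricGroup, Qut, h]
  exact .refl _

variable [Fintype V] [Fintype W] [Fintype V'] [Fintype W']

theorem qut_bot_lexProduct_equal [Nonempty W'] (n : ℕ) {Y : SimpleGraph W'}
    (hY : Y.Preconnected) : (Qut (lexProduct (⊥ : SimpleGraph (Fin n)) Y)).Equal
      ((Qut Y).freeWreath (quantumSymmetricGroup n)) := by
  refine (qut_lexProduct_equal_freeWreath ?_).trans ((QuantumPermGroup.Equal.refl _).freeWreath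
    (qut_bot_equal n))
  -- The complement of the empty graph is `K_n`: twin-free and regular of degree `n - 1`, vacuously
  -- when `n = 0`.
  refine preserves_fst_of_preconnected (l := n - 1) (QuantumPermGroup.isMagicUnitary _)
    (qut_preserves _) ?_ ?_ hY
  · intro i
    have h : {z | (⊥ : SimpleGraph (Fin n))ᶜ.Adj i z} = {i}ᶜ := by
      ext z
      simp [eq_comm]
    rw [h, Set.ncard_compl, Set.ncard_singleton, Nat.card_fin]
  · intro i j h
    by_contra hij
    have := (h j).1
    simp [hij] at this

/-- After regrouping, the outer graph `X'` is twin-free and the inner graph has connected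
complement, although neither `X` nor `Y` need have these properties. -/
theorem qut_lexProduct_equalVia_merge [Nonempty W'] {m n : ℕ} [NeZero m] [NeZero n] (hmn : 1 < m * n)
    {X : SimpleGraph V} {Y : SimpleGraph W} {X' : SimpleGraph V'} {Y' : SimpleGraph W'}
    (hX' : IsQuantumVertexTransitive X') (hT : TwinFree X') (hY' : Y'.Preconnected)
    (φ : X ≃g lexProduct X' (⊥ : SimpleGraph (Fin m)))
    (ψ : Y ≃g lexProduct (⊥ : SimpleGraph (Fin n)) Y') :
    (Qut (lexProduct X Y)).EqualVia (mergeEquiv φ.toEquiv ψ.toEquiv)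
      (((Qut Y').freeWreath (quantumSymmetricGroup (m * n))).freeWreath (Qut X')) := by
  obtain ⟨k, hk⟩ := hX'.exists_hasDegree
  refine (qut_equalVia_of_iso (mergeIso φ ψ)).trans (f := Equiv.refl _)
    (QuantumPermGroup.Equal.trans (qut_lexProduct_equal_freeWreath ?_)
      ((qut_bot_lexProduct_equal (m * n) hY').freeWreath (.refl _)))
  exact preserves_fst_of_compl_preconnected (QuantumPermGroup.isMagicUnitary _)
    (qut_preserves _) hk hT (compl_bot_lexProduct_preconnected hmn Y')

theorem qut_lexProduct_equalVia_of_isGreatest {X : SimpleGraph V} {Y : SimpleGraph W}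
    (hX : IsQuantumVertexTransitive X) (hY : IsVertexTransitive Y) {α β : ℕ+} (h1 : 1 < α)
    (hα : IsGreatest {a : ℕ+ | HasOuterFactor X (⊥ : SimpleGraph (Fin a))} α)
    (hβ : IsGreatest {b : ℕ+ | HasInnerFactor Y (⊥ : SimpleGraph (Fin b))} β)
    [Nonempty W'] {X' : SimpleGraph V'} {Y' : SimpleGraph W'}
    (hX' : IsQuantumVertexTransitive X')
    (φ : X ≃g lexProduct X' (⊥ : SimpleGraph (Fin α)))
    (ψ : Y ≃g lexProduct (⊥ : SimpleGraph (Fin β)) Y') :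
    (Qut (lexProduct X Y)).EqualVia (mergeEquiv φ.toEquiv ψ.toEquiv)
      (((Qut Y').freeWreath (quantumSymmetricGroup (α * β))).freeWreath (Qut X')) :=
  qut_lexProduct_equalVia_merge (one_lt_mul_of_lt_of_le (PNat.coe_lt_coe 1 α |>.2 h1) β.pos) hX'
    (hX.twinFree_of_isGreatest hα φ) (hY.preconnected_of_isGreatest hβ ψ) φ ψ

/-- Sabidussi's conditions suffice when `X` is quantum vertex-transitive. -/
theorem qut_lexProduct_equal_of_sabidussi [Nonempty W] {X : SimpleGraph V} {Y : SimpleGraph W}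
    (hX : IsQuantumVertexTransitive X) (h1 : TwinFree X ∨ Y.Preconnected)
    (h2 : TwinFree Xᶜ ∨ Yᶜ.Preconnected) :
    (Qut (lexProduct X Y)).Equal ((Qut Y).freeWreath (Qut X)) := by
  have hu := (Qut (lexProduct X Y)).isMagicUnitary
  have hL := qut_preserves (lexProduct X Y)
  obtain ⟨k, hk⟩ := hX.exists_hasDegree
  obtain ⟨l, hl⟩ := hX.compl.exists_hasDegree
  apply qut_lexProduct_equal_freeWreath
  by_cases hT : TwinFree X
  · rcases h2 with hT' | hY
    · exact preserves_fst_of_twinFree hu hL hk hT hl hT'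
    · exact preserves_fst_of_compl_preconnected hu hL hk hT hY
  -- When `X` has twins, `Xᶜ` has none and `Y` must be connected.
  · exact preserves_fst_of_preconnected hu hL hl (hX.twinFree_or.resolve_left hT)
      (h1.resolve_left hT)

end Main

theorem mainTheorem9 {V W : Type} [Fintype V] [Fintype W] [Nonempty W]
    (X : SimpleGraph V) (Y : SimpleGraph W)
    (hX : IsQuantumVertexTransitive X) (hY : IsVertexTransitive Y)
    (h : ¬ (Qut (lexProduct X Y)).Equal ((Qut Y).freeWreath (Qut X))) :
    -- existence of `α, β > 1`, which may be taken maximal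
    (∃ α β : ℕ+, 1 < α ∧ 1 < β ∧
      ((IsGreatest {a : ℕ+ | HasOuterFactor X (⊥ : SimpleGraph (Fin a))} α ∧
          IsGreatest {b : ℕ+ | HasInnerFactor Y (⊥ : SimpleGraph (Fin b))} β) ∨
        (IsGreatest {a : ℕ+ | HasOuterFactor X (⊤ : SimpleGraph (Fin a))} α ∧
          IsGreatest {b : ℕ+ | HasInnerFactor Y (⊤ : SimpleGraph (Fin b))} β))) ∧
    -- the quantum automorphism group when `X = X'[K̄_α]`, `Y = K̄_β[Y']` with `α, β` maximal
    (∀ α β : ℕ+, 1 < α → 1 < β →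
      IsGreatest {a : ℕ+ | HasOuterFactor X (⊥ : SimpleGraph (Fin a))} α →
      IsGreatest {b : ℕ+ | HasInnerFactor Y (⊥ : SimpleGraph (Fin b))} β →
      ∀ (V' W' : Type) [Fintype V'] [Fintype W'] [Nonempty W']
        (X' : SimpleGraph V') (Y' : SimpleGraph W'),
        IsQuantumVertexTransitive X' → IsVertexTransitive Y' →
        ∀ (φ : X ≃g lexProduct X' (⊥ : SimpleGraph (Fin α)))
          (ψ : Y ≃g lexProduct (⊥ : SimpleGraph (Fin β)) Y'),
          (Qut (lexProduct X Y)).EqualVia (mergeEquiv φ.toEquiv ψ.toEquiv)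
            (((Qut Y').freeWreath (quantumSymmetricGroup (α * β))).freeWreath (Qut X'))) ∧
    -- the quantum automorphism group when `X = X'[K_α]`, `Y = K_β[Y']` with `α, β` maximal
    (∀ α β : ℕ+, 1 < α → 1 < β →
      IsGreatest {a : ℕ+ | HasOuterFactor X (⊤ : SimpleGraph (Fin a))} α →
      IsGreatest {b : ℕ+ | HasInnerFactor Y (⊤ : SimpleGraph (Fin b))} β →
      ∀ (V' W' : Type) [Fintype V'] [Fintype W'] [Nonempty W']
        (X' : SimpleGraph V') (Y' : SimpleGraph W'),
        IsQuantumVertexTransitive X' → IsVertexTransitive Y' →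
        ∀ (φ : X ≃g lexProduct X' (⊤ : SimpleGraph (Fin α)))
          (ψ : Y ≃g lexProduct (⊤ : SimpleGraph (Fin β)) Y'),
          (Qut (lexProduct X Y)).EqualVia (mergeEquiv φ.toEquiv ψ.toEquiv)
            (((Qut Y').freeWreath (quantumSymmetricGroup (α * β))).freeWreath (Qut X'))) := by
  refine ⟨?_, fun α β h1 _ hα hβ V' W' _ _ _ X' Y' hX' _ φ ψ =>
    qut_lexProduct_equalVia_of_isGreatest hX hY h1 hα hβ hX' φ ψ,
    fun α β h1 _ hα hβ V' W' _ _ _ X' Y' hX' _ φ ψ => ?_⟩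
  -- The two ways in which Sabidussi's conditions fail correspond to the two types of decomposition.
  · have h0 : (¬ TwinFree X ∧ ¬ Y.Preconnected) ∨ (¬ TwinFree Xᶜ ∧ ¬ Yᶜ.Preconnected) := by
      by_contra h0
      exact h (qut_lexProduct_equal_of_sabidussi hX (by tauto) (by tauto))
    rcases h0 with ⟨hT, hC⟩ | ⟨hT, hC⟩
    · obtain ⟨α, h1, hα⟩ := hX.exists_isGreatest_outer hT
      obtain ⟨β, h2, hβ⟩ := hY.exists_isGreatest_inner hC
      exact ⟨α, β, h1, h2, Or.inl ⟨hα, hβ⟩⟩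
    · obtain ⟨α, h1, hα⟩ := hX.compl.exists_isGreatest_outer hT
      obtain ⟨β, h2, hβ⟩ := hY.compl.exists_isGreatest_inner hC
      simp only [hasOuterFactor_compl_bot] at hα
      simp only [hasInnerFactor_compl_bot] at hβ
      exact ⟨α, β, h1, h2, Or.inr ⟨hα, hβ⟩⟩
  · simp only [← hasOuterFactor_compl_bot] at hα
    simp only [← hasInnerFactor_compl_bot] at hβ
    -- The complement of `⊤` is `⊥` only up to a proved equality; general `K` and `L` let it be
    -- substituted without altering the underlying bijections.
    have key : ∀ {K : SimpleGraph (Fin α)} {L : SimpleGraph (Fin β)}, K = ⊥ → L = ⊥ →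
        ∀ (φ : Xᶜ ≃g lexProduct X'ᶜ K) (ψ : Yᶜ ≃g lexProduct L Y'ᶜ),
        (Qut (lexProduct Xᶜ Yᶜ)).EqualVia (mergeEquiv φ.toEquiv ψ.toEquiv)
          (((Qut Y'ᶜ).freeWreath (quantumSymmetricGroup (α * β))).freeWreath (Qut X'ᶜ)) := by
      rintro K L rfl rfl φ ψ
      exact qut_lexProduct_equalVia_of_isGreatest hX.compl hY.compl h1 hα hβ hX'.compl φ ψ
    have h4 := qut_equal_compl (lexProduct X Y)
    rw [lexProduct_compl] at h4
    exact (QuantumPermGroup.EqualVia.trans (e := Equiv.refl _) h4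
      (key compl_top compl_top (complLexIso φ) (complLexIso ψ))).trans (f := Equiv.refl _)
        (((qut_equal_compl Y').symm.freeWreath (.refl _)).freeWreath (qut_equal_compl X').symm)
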